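/- Let $n\ge 1$. A real $n\times n$ matrix $A$ is called a dilation if all its eigenvalues $\lambda$, real or complex, satisfy $|\lambda|>1$. A quasi-norm associated with a dilation $A$ is a (Lebesgue) measurable map $\rho:\mathbb R^n\to[0,\infty)$ such that $\rho(x)=0$ if and only if $x=0$; $\rho(Ax)=|\det A|\,\rho(x)$ for all $x\in\mathbb R^n$; and, for some constant $c$, $\rho(x+y)\le c(\rho(x)+\rho(y))$ for all $x,y\in\mathbb R^n$. Two quasi-norms $\rho_1,\rho_2$ are equivalent if there is $C>0$ with $\frac1C\rho_1(x)\le\rho_2(x)\le C\rho_1(x)$ for all $x\in\mathbb R^n$. Two dilations $A,B$ are equivalent if some quasi-norm associated with $A$ is equivalent to some quasi-norm associated with $B$ (the choice is immaterial, since any two quasi-norms associated with the same dilation are equivalent). For every dilation $A$ there is a unique real $n\times n$ matrix $P$ such that all (complex) eigenvalues of $P$ are real and positive, $\operatorname{tr}P=1$, and $A$ is equivalent to the dilation $A_t=\exp(P\ln t)$ for every $t>1$; call $P$ the generator corresponding to $A$. Let $\rho_1$ and $\rho_2$ be any quasi-norms associated with dilations $A_1$ and $A_2$, respectively, and let $P_1$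 and $P_2$ be the generators corresponding to $A_1$ and $A_2$. Then $\rho_1$ and $\rho_2$ are equivalent if and only if $P_1=P_2$. -/

import Mathlib

open scoped NNReal

/-- `z` is a (real or complex) eigenvalue of the real square matrix `A`. -/
def IsComplexEigenvalue {n : ℕ} (A : Matrix (Fin n) (Fin n) ℝ) (z : ℂ) : Prop :=
  Module.End.HasEigenvalue (Matrix.toLin' (A.map (algebraMap ℝ ℂ))) z

/-- Anisotropic dilation matrix: all eigenvalues, real or complex, have modulus `> 1`. -/
def IsAnisotropicDilation {n : ℕ} (A : Matrix (Fin n) (Fin n) ℝ) : Prop :=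
  ∀ z : ℂ, IsComplexEigenvalue A z → 1 < ‖z‖

/-- `ρ` is a homogeneous quasi-norm associated with the matrix `A`.  Measurability is Lebesgue
measurability, i.e. measurability with respect to the completed Lebesgue σ-algebra. -/
structure IsAssociatedQuasiNorm {n : ℕ} (A : Matrix (Fin n) (Fin n) ℝ)
    (ρ : (Fin n → ℝ) → ℝ≥0) : Prop where
  measurable : MeasureTheory.NullMeasurable ρ MeasureTheory.volume
  eq_zero_iff : ∀ x, ρ x = 0 ↔ x = 0
  homogeneous : ∀ x, (ρ (A.mulVec x) : ℝ) = |A.det| * ρ x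
  quasi_triangle : ∃ c : ℝ, ∀ x y, (ρ (x + y) : ℝ) ≤ c * (ρ x + ρ y)

/-- Equivalence of two (quasi-norm) functions. -/
def QuasiNormEquiv {n : ℕ} (ρ₁ ρ₂ : (Fin n → ℝ) → ℝ≥0) : Prop :=
  ∃ C : ℝ, 0 < C ∧ ∀ x, 1 / C * (ρ₁ x : ℝ) ≤ ρ₂ x ∧ (ρ₂ x : ℝ) ≤ C * ρ₁ x

/-- Equivalence of two dilations: their associated quasi-norms are equivalent.  Every dilation has
an associated quasi-norm and any two quasi-norms associated with the same dilation are equivalent,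
so it does not matter which ones are compared. -/
def EquivalentDilations {n : ℕ} (A B : Matrix (Fin n) (Fin n) ℝ) : Prop :=
  IsAnisotropicDilation A ∧ IsAnisotropicDilation B ∧
    ∃ ρ₁ ρ₂ : (Fin n → ℝ) → ℝ≥0,
      IsAssociatedQuasiNorm A ρ₁ ∧ IsAssociatedQuasiNorm B ρ₂ ∧ QuasiNormEquiv ρ₁ ρ₂

/-- The element `A_t = exp (P ln t)`, `t > 0`, of the continuous group with generator `P`. -/
noncomputable def continuousGroup {n : ℕ} (P : Matrix (Fin n) (Fin n) ℝ) (t : ℝ) :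
    Matrix (Fin n) (Fin n) ℝ :=
  NormedSpace.exp (Real.log t • P)

/-- `P` generates the continuous group associated with the dilation `A`: all eigenvalues of `P`
(over `ℂ`) are real and positive, `P` has trace one, and `A` is equivalent to
`A_t = exp (P ln t)` for all `t > 1`. -/
structure IsAssociatedGenerator {n : ℕ} (A P : Matrix (Fin n) (Fin n) ℝ) : Prop where
  eigenvalue_pos : ∀ z : ℂ, IsComplexEigenvalue P z → z.im = 0 ∧ 0 < z.re
  trace_eq_one : P.trace = 1
  equiv : ∀ t : ℝ, 1 < t → EquivalentDilations A (continuousGroup P t)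

/-! ### Matrix exponentials on generalized eigenvectors, and decay of exp(-sP). -/

section MatrixExponential

open Matrix Filter Topology
open scoped Matrix.Norms.Operator Nat

variable {ι : Type*} [Fintype ι] [DecidableEq ι]

/-! A quasi-norm of a dilation `A` is comparable to a gauge built from a one-parameter group
exp(sP), and such a gauge determines `P` because `P` has real spectrum.

Existence: separate the moduli of the eigenvalues from their arguments. By
`exists_exp_mul_zpow_bounded`, `A = exp(L) U` with `L` and `U` commuting, each eigenvalue of `L` of
the form log|μ| for an eigenvalue μ of `A`, and `U` power bounded. Then |det U| = 1, so tr L =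
log|det A| > 0 and P = L / tr L has trace one. The points whose `U`-orbit meets the unit ball form
an open, bounded, `U`-invariant set. Its gauge under exp(sP) does not see `U`, so it is a quasi-norm
for `A` and for every A_t with t > 1 at once.

Uniqueness and the criterion: two quasi-norms of one dilation are equivalent
(`IsAssociatedQuasiNorm.quasiNormEquiv`), by Steinhaus' theorem, compactness and homogeneity. Each
quasi-norm may therefore be replaced by the unit-ball gauge of its generator. Equivalence of the
gauges of `P` and `Q` bounds exp(-sP) exp(sQ) uniformly over real s. Between generalized
eigenvectors the coefficients of this product are exp(as) p(s), with `a` real and `p` a polynomial.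
Being bounded on the whole line, they are constant (`exp_mul_eval_eq_of_bounded`); hence exp(sP) =
exp(sQ) and P = Q (`eq_of_exp_mul_exp_bounded`). -/

/-- The exponential series of a matrix is a finite sum on vectors killed by a power of it. -/
theorem exp_mulVec_eq_sum (M : Matrix ι ι ℂ) (w : ι → ℂ) (m : ℕ) (h : (M ^ m) *ᵥ w = 0) :
    NormedSpace.exp M *ᵥ w = ∑ j ∈ Finset.range m, ((j ! : ℂ)⁻¹) • ((M ^ j) *ᵥ w) := by
  have h1 : HasSum (fun j : ℕ => ((j ! : ℂ)⁻¹) • M ^ j) (NormedSpace.exp M) :=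
    NormedSpace.exp_series_hasSum_exp' M
  have h2 : HasSum (fun j : ℕ => (((j ! : ℂ)⁻¹) • M ^ j) *ᵥ w) (NormedSpace.exp M *ᵥ w) :=
    h1.map (AddMonoidHom.mk' (fun X : Matrix ι ι ℂ => X *ᵥ w) (fun X Y => add_mulVec X Y w))
      (continuous_id.matrix_mulVec continuous_const)
  have h3 : HasSum (fun j : ℕ => (((j ! : ℂ)⁻¹) • M ^ j) *ᵥ w)
      (∑ j ∈ Finset.range m, (((j ! : ℂ)⁻¹) • M ^ j) *ᵥ w) := by
    refine hasSum_sum_of_ne_finset_zero fun j hj => ?_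
    have hj' : m ≤ j := by simpa using hj
    rw [← Nat.sub_add_cancel hj', pow_add, smul_mulVec, ← mulVec_mulVec, h]
    simp
  rw [h2.unique h3]
  simp [smul_mulVec]

/-- Split `M` into the scalar μ and `M - μ`, which commute; on `w` the series of the second factor
stops. -/
theorem exp_smul_mulVec_eq (M : Matrix ι ι ℂ) (μ : ℂ) (w : ι → ℂ) (m : ℕ)
    (h : ((M - μ • 1) ^ m) *ᵥ w = 0) (s : ℂ) :
    NormedSpace.exp (s • M) *ᵥ w = Complex.exp (s * μ) •
      ∑ j ∈ Finset.range m, (s ^ j * (j ! : ℂ)⁻¹) • (((M - μ • 1) ^ j) *ᵥ w) := by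
  have e : s • M = (s * μ) • (1 : Matrix ι ι ℂ) + s • (M - μ • 1) := by
    rw [smul_sub, smul_smul]; abel
  have hc : Commute ((s * μ) • (1 : Matrix ι ι ℂ)) (s • (M - μ • 1)) :=
    (Commute.one_left _).smul_left _
  have h1 : NormedSpace.exp ((s * μ) • (1 : Matrix ι ι ℂ)) = Complex.exp (s * μ) • 1 := by
    have := NormedSpace.algebraMap_exp_comm (𝔸 := Matrix ι ι ℂ) (s * μ)
    rw [Algebra.algebraMap_eq_smul_one, Algebra.algebraMap_eq_smul_one] at this
    rw [Complex.exp_eq_exp_ℂ]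
    exact this.symm
  rw [e, Matrix.exp_add_of_commute _ _ hc, h1, smul_one_mul, smul_mulVec,
    exp_mulVec_eq_sum _ w m]
  · congr 1
    refine Finset.sum_congr rfl fun j _ => ?_
    rw [smul_pow, smul_mulVec, smul_smul, mul_comm]
  · rw [smul_pow, smul_mulVec, h, smul_zero]

/-- A subspace containing all generalized eigenvectors is everything. -/
theorem eq_top_of_generalizedEigenvectors_mem (M : Matrix ι ι ℂ) (p : Submodule ℂ (ι → ℂ))
    (h : ∀ μ, Module.End.HasEigenvalue (Matrix.toLin' M) μ → ∀ m w,
      ((M - μ • 1) ^ m) *ᵥ w = 0 → w ∈ p) : p = ⊤ := by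
  rw [← top_le_iff, ← Module.End.iSup_maxGenEigenspace_eq_top (Matrix.toLin' M)]
  refine iSup_le fun μ w hw => ?_
  by_cases hμ : Module.End.HasEigenvalue (Matrix.toLin' M) μ
  · obtain ⟨k, hk⟩ := Module.End.mem_maxGenEigenspace _ _ _ |>.1 hw
    refine h μ hμ k w ?_
    have : (toLin' M - μ • (1 : Module.End ℂ (ι → ℂ))) = toLin' (M - μ • 1) := by
      simp [Module.End.one_eq_id]
    rw [this, ← toLin'_pow, toLin'_apply] at hk
    exact hk
  · have hb : Module.End.maxGenEigenspace (Matrix.toLin' M) μ = ⊥ := by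
      by_contra hne
      apply hμ
      have := Module.End.hasUnifEigenvalue_iff_hasUnifEigenvalue_one (f := Matrix.toLin' M)
        (μ := μ) (k := ⊤) (by simp)
      exact this.1 hne
    rw [hb] at hw
    simp only [Submodule.mem_bot] at hw
    simp [hw]

/-- Complexification of a real matrix. -/
noncomputable abbrev complexify : Matrix ι ι ℝ →+* Matrix ι ι ℂ := (algebraMap ℝ ℂ).mapMatrix

theorem complexify_injective : Function.Injective (complexify (ι := ι)) :=
  Matrix.map_injective (algebraMap ℝ ℂ).injective

theorem continuous_complexify : Continuous (complexify (ι := ι)) :=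
  continuous_id.matrix_map Complex.continuous_ofReal

theorem complexify_exp (M : Matrix ι ι ℝ) :
    complexify (NormedSpace.exp M) = NormedSpace.exp (complexify M) :=
  NormedSpace.map_exp _ continuous_complexify M

theorem complexify_smul (s : ℝ) (M : Matrix ι ι ℝ) :
    complexify (s • M) = (s : ℂ) • complexify M := by
  ext i j; simp

theorem complexify_mulVec (M : Matrix ι ι ℝ) (x : ι → ℝ) :
    complexify M *ᵥ (fun i => (x i : ℂ)) = fun i => ((M *ᵥ x) i : ℂ) := by
  ext i; simp [mulVec, dotProduct]

theorem norm_complexify (M : Matrix ι ι ℝ) : ‖complexify M‖ = ‖M‖ := by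
  rw [linfty_opNorm_def, linfty_opNorm_def]
  simp

/-- On a generalized eigenvector the orbit is a polynomial in s times exp(-sμ) with Re μ > 0; such
vectors span. -/
theorem tendsto_exp_neg_smul_zero (P : Matrix ι ι ℝ)
    (hP : ∀ z : ℂ, Module.End.HasEigenvalue (Matrix.toLin' (complexify P)) z → 0 < z.re) :
    Tendsto (fun s : ℝ => NormedSpace.exp ((-s) • P)) atTop (𝓝 0) := by
  let p : Submodule ℂ (ι → ℂ) :=
    { carrier := {w | Tendsto (fun s : ℝ => NormedSpace.exp ((-s : ℂ) • complexify P) *ᵥ w)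
        atTop (𝓝 0)}
      add_mem' := fun {a b} ha hb => by
        simpa [mulVec_add] using ha.add hb
      zero_mem' := by simp
      smul_mem' := fun c w hw => by
        simpa [mulVec_smul] using hw.const_smul c }
  have hp : p = ⊤ := by
    refine eq_top_of_generalizedEigenvectors_mem (complexify P) p fun μ hμ m w hw => ?_
    change Tendsto _ _ _
    simp_rw [exp_smul_mulVec_eq (complexify P) μ w m hw, Finset.smul_sum, smul_smul]
    have : (0 : ι → ℂ) = ∑ j ∈ Finset.range m, (0 : ℂ) • (((complexify P - μ • 1) ^ j) *ᵥ w) := by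
      simp
    rw [this]
    refine tendsto_finsetSum _ fun j _ => Tendsto.smul_const ?_ _
    rw [tendsto_zero_iff_norm_tendsto_zero]
    have hre := hP μ hμ
    have h1 : Tendsto (fun s : ℝ => s ^ (j : ℝ) * Real.exp (-μ.re * s) * (j ! : ℝ)⁻¹) atTop (𝓝 0) := by
      simpa using (tendsto_rpow_mul_exp_neg_mul_atTop_nhds_zero (j : ℝ) μ.re hre).mul_const
        ((j ! : ℝ)⁻¹)
    refine h1.congr' ?_
    filter_upwards [eventually_ge_atTop 0] with s hs
    rw [norm_mul, norm_mul, Complex.norm_exp, norm_pow, norm_neg, norm_inv]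
    simp [abs_of_nonneg hs]
    ring_nf
  refine tendsto_pi_nhds.2 fun i => tendsto_pi_nhds.2 fun j => ?_
  have hj : (Pi.single j 1 : ι → ℂ) ∈ p := by rw [hp]; trivial
  have h2 := (tendsto_pi_nhds.1 (show Tendsto _ _ _ from hj) i)
  have h3 : ∀ s : ℝ, (NormedSpace.exp ((-s : ℂ) • complexify P) *ᵥ (Pi.single j 1 : ι → ℂ)) i =
      ((NormedSpace.exp ((-s) • P) i j : ℝ) : ℂ) := fun s => by
    rw [← Complex.ofReal_neg, ← complexify_smul, ← complexify_exp]
    simp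
  simp_rw [h3] at h2
  have h4 := (Complex.continuous_re.tendsto _).comp h2
  simpa [Function.comp_def] using h4

end MatrixExponential

/-! ### Bounded exponential polynomials. -/

section ExponentialPolynomials

open Polynomial Filter Topology

theorem degree_le_zero_of_norm_eval_le (p : ℂ[X]) (C : ℝ)
    (h : ∀ s : ℝ, 0 ≤ s → ‖p.eval (s : ℂ)‖ ≤ C) : p.degree ≤ 0 := by
  by_contra hd
  have h1 := p.tendsto_norm_atTop (not_le.1 hd) (l := atTop) (z := fun s : ℝ => (s : ℂ))
    (by simpa using tendsto_abs_atTop_atTop)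
  obtain ⟨s, hs, hs0⟩ := ((h1.eventually_gt_atTop C).and (eventually_ge_atTop 0)).exists
  exact absurd (h s hs0) (not_le.2 hs)

theorem exp_mul_eval_eq_of_bounded_aux (a : ℝ) (ha : 0 ≤ a) (p : ℂ[X]) (C : ℝ)
    (h : ∀ s : ℝ, ‖Complex.exp (a * s) * p.eval (s : ℂ)‖ ≤ C) (s : ℝ) :
    Complex.exp (a * s) * p.eval (s : ℂ) = p.eval 0 := by
  have h' : ∀ s : ℝ, Real.exp (a * s) * ‖p.eval (s : ℂ)‖ ≤ C := fun s => by
    simpa [Complex.norm_exp] using h s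
  have hd : p.degree ≤ 0 := by
    refine degree_le_zero_of_norm_eval_le p C fun s hs => le_trans ?_ (h' s)
    have : 1 ≤ Real.exp (a * s) := Real.one_le_exp (by positivity)
    nlinarith [norm_nonneg (p.eval (s : ℂ))]
  rw [eq_C_of_degree_le_zero hd] at h' ⊢
  simp only [eval_C] at h' ⊢
  rcases ha.eq_or_lt with rfl | ha
  · simp
  · suffices p.coeff 0 = 0 by simp [this]
    by_contra hc
    have hc' : 0 < ‖p.coeff 0‖ := norm_pos_iff.2 hc
    -- Growth at +∞ excludes a nonzero coefficient when `a > 0`; negative exponents reduce to this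
    -- case by s ↦ -s.
    have h1 : Tendsto (fun s : ℝ => Real.exp (a * s) * ‖p.coeff 0‖) atTop atTop :=
      (Real.tendsto_exp_atTop.comp (tendsto_id.const_mul_atTop ha)).atTop_mul_const hc'
    obtain ⟨s, hs⟩ := (h1.eventually_gt_atTop C).exists
    exact absurd (h' s) (not_le.2 hs)

/-- A bounded exponential polynomial with a real exponent is constant. -/
theorem exp_mul_eval_eq_of_bounded (a : ℝ) (p : ℂ[X]) (C : ℝ)
    (h : ∀ s : ℝ, ‖Complex.exp (a * s) * p.eval (s : ℂ)‖ ≤ C) (s : ℝ) :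
    Complex.exp (a * s) * p.eval (s : ℂ) = p.eval 0 := by
  rcases le_total 0 a with ha | ha
  · exact exp_mul_eval_eq_of_bounded_aux a ha p C h s
  · have := exp_mul_eval_eq_of_bounded_aux (-a) (by linarith) (p.comp (-X)) C
      (fun s => by simpa using h (-s)) (-s)
    simpa using this

end ExponentialPolynomials

/-! ### Rigidity of groups with real spectrum; determinant of the exponential. -/

section Uniqueness

open Matrix Filter Topology
open scoped Matrix.Norms.Operator Nat

variable {ι : Type*} [Fintype ι] [DecidableEq ι]

theorem hasEigenvalue_toLin'_transpose (M : Matrix ι ι ℂ) (z : ℂ) :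
    Module.End.HasEigenvalue (toLin' Mᵀ) z ↔ Module.End.HasEigenvalue (toLin' M) z := by
  rw [Module.End.hasEigenvalue_iff_isRoot_charpoly, Module.End.hasEigenvalue_iff_isRoot_charpoly,
    Matrix.charpoly_toLin', Matrix.charpoly_toLin', Matrix.charpoly_transpose]

/-- Generators with real spectrum whose groups stay at bounded distance are equal. -/
theorem eq_of_exp_mul_exp_bounded (P Q : Matrix ι ι ℝ)
    (hP : ∀ z : ℂ, Module.End.HasEigenvalue (toLin' (complexify P)) z → z.im = 0)
    (hQ : ∀ z : ℂ, Module.End.HasEigenvalue (toLin' (complexify Q)) z → z.im = 0)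
    (K : ℝ) (hK : ∀ s : ℝ, ‖NormedSpace.exp ((-s) • P) * NormedSpace.exp (s • Q)‖ ≤ K) :
    P = Q := by
  set M : ℝ → Matrix ι ι ℂ := fun s =>
    NormedSpace.exp ((-s : ℂ) • complexify P) * NormedSpace.exp ((s : ℂ) • complexify Q) with hM
  have hMc : ∀ s, M s = complexify (NormedSpace.exp ((-s) • P) * NormedSpace.exp (s • Q)) := by
    intro s
    rw [map_mul, complexify_exp, complexify_exp, complexify_smul, complexify_smul,
      Complex.ofReal_neg]
  have hMK : ∀ s, ‖M s‖ ≤ K := fun s => by rw [hMc, norm_complexify]; exact hK s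
  let W : Submodule ℂ (ι → ℂ) :=
    { carrier := {w | ∀ s, M s *ᵥ w = w}
      add_mem' := fun {a b} ha hb s => by rw [mulVec_add, ha s, hb s]
      zero_mem' := fun s => by simp
      smul_mem' := fun c w hw s => by rw [mulVec_smul, hw s] }
  have hW : W = ⊤ := by
    refine eq_top_of_generalizedEigenvectors_mem (complexify Q) W fun μ hμ m w hw => ?_
    -- Test against row vectors: moved across the pairing, exp(-sP) becomes exp(-sPᵀ), so
    -- generalized eigenvectors of the transpose suffice.
    let V : Submodule ℂ (ι → ℂ) :=
      { carrier := {u | ∀ s, u ⬝ᵥ (M s *ᵥ w) = u ⬝ᵥ w}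
        add_mem' := fun {a b} ha hb s => by rw [add_dotProduct, ha s, hb s, add_dotProduct]
        zero_mem' := fun s => by simp
        smul_mem' := fun c w hw s => by rw [smul_dotProduct, hw s, smul_dotProduct] }
    have hV : V = ⊤ := by
      refine eq_top_of_generalizedEigenvectors_mem (complexify P)ᵀ V fun ν hν k u hu => ?_
      have hν' := hP ν ((hasEigenvalue_toLin'_transpose _ _).1 hν)
      have hμ' := hQ μ hμ
      -- Real spectra are used here: an imaginary part would leave a bounded oscillating
      -- exponential, which need not be constant.
      let a : ℝ := μ.re - ν.re
      let p : Polynomial ℂ := ∑ i ∈ Finset.range k, ∑ j ∈ Finset.range m,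
        Polynomial.C ((-1) ^ i * (i ! : ℂ)⁻¹ * (j ! : ℂ)⁻¹ *
          ((((complexify P)ᵀ - ν • 1) ^ i *ᵥ u) ⬝ᵥ ((complexify Q - μ • 1) ^ j *ᵥ w))) *
          Polynomial.X ^ (i + j)
      have hform : ∀ s : ℝ, u ⬝ᵥ (M s *ᵥ w) = Complex.exp (a * s) * p.eval (s : ℂ) := by
        intro s
        have h1 : u ⬝ᵥ (M s *ᵥ w) = (NormedSpace.exp ((-s : ℂ) • (complexify P)ᵀ) *ᵥ u) ⬝ᵥ
            (NormedSpace.exp ((s : ℂ) • complexify Q) *ᵥ w) := by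
          rw [hM, ← mulVec_mulVec, dotProduct_mulVec, ← mulVec_transpose, ← Matrix.exp_transpose,
            transpose_smul]
        rw [h1, exp_smul_mulVec_eq _ ν u k hu, exp_smul_mulVec_eq _ μ w m hw, smul_dotProduct,
          dotProduct_smul, smul_smul, ← Complex.exp_add]
        have h2 : (-s : ℂ) * ν + s * μ = a * s := by
          apply Complex.ext
          · simp [a, hν', hμ']
            ring
          · simp [a, hν', hμ']
        rw [h2, smul_eq_mul]
        congr 1
        simp only [p, Polynomial.eval_finsetSum, sum_dotProduct]
        refine Finset.sum_congr rfl fun i _ => ?_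
        rw [dotProduct_sum]
        refine Finset.sum_congr rfl fun j _ => ?_
        simp only [smul_dotProduct, dotProduct_smul, smul_eq_mul, Polynomial.eval_mul,
          Polynomial.eval_C, Polynomial.eval_pow, Polynomial.eval_X]
        rw [neg_pow, pow_add]
        ring
      have hbd : ∀ s : ℝ, ‖Complex.exp (a * s) * p.eval (s : ℂ)‖ ≤ (∑ i, ‖u i‖) * (K * ‖w‖) := by
        intro s
        rw [← hform, dotProduct, Finset.sum_mul]
        refine (norm_sum_le _ _).trans (Finset.sum_le_sum fun i _ => ?_)
        rw [norm_mul]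
        gcongr
        refine (norm_le_pi_norm _ i).trans ((linfty_opNorm_mulVec _ _).trans ?_)
        gcongr
        exact hMK s
      intro s
      have h0 : M 0 = 1 := by simp [hM]
      rw [hform, exp_mul_eval_eq_of_bounded a p _ hbd s, ← one_mulVec w, ← h0, hform]
      simp
    intro s
    ext i
    have := (show Pi.single i 1 ∈ V by rw [hV]; trivial) s
    simpa using this
  have hexp : ∀ s : ℝ, NormedSpace.exp (s • P) = NormedSpace.exp (s • Q) := by
    intro s
    have h1 : M s = 1 := by
      refine Matrix.ext_of_mulVec_single fun i => ?_
      rw [one_mulVec]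
      exact (show Pi.single i 1 ∈ W by rw [hW]; trivial) s
    rw [hMc, ← map_one (complexify (ι := ι))] at h1
    have h2 := complexify_injective h1
    rw [neg_smul, Matrix.exp_neg] at h2
    have hu := (Matrix.isUnit_iff_isUnit_det _).1 (Matrix.isUnit_exp (s • P))
    calc NormedSpace.exp (s • P) = NormedSpace.exp (s • P) *
        ((NormedSpace.exp (s • P))⁻¹ * NormedSpace.exp (s • Q)) := by rw [h2, mul_one]
      _ = _ := by rw [← mul_assoc, Matrix.mul_nonsing_inv _ hu, one_mul]
  have d1 := hasDerivAt_exp_smul_const P (0 : ℝ)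
  have d2 := hasDerivAt_exp_smul_const Q (0 : ℝ)
  have h3 : (fun s : ℝ => NormedSpace.exp (s • P)) = fun s : ℝ => NormedSpace.exp (s • Q) :=
    funext hexp
  have h4 := d1.unique (h3 ▸ d2)
  simpa using h4

/-- Jacobi's formula for the exponential. -/
theorem det_exp_smul (M : Matrix ι ι ℝ) (t : ℝ) :
    (NormedSpace.exp (t • M)).det = Real.exp (t * M.trace) := by
  set f : ℝ → ℝ := fun t => (NormedSpace.exp (t • M)).det with hf
  have hE := hasDerivAt_exp_smul_const M (0 : ℝ)
  have hent : ∀ i j, HasDerivAt (fun t : ℝ => NormedSpace.exp (t • M) i j) (M i j) 0 := by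
    intro i j
    have := (hasDerivAt_pi.1 ((hasDerivAt_pi.1 hE) i)) j
    rw [zero_smul, NormedSpace.exp_zero, one_mul] at this
    exact this
  have h0 : HasDerivAt f M.trace 0 := by
    have h1 : HasDerivAt (fun t : ℝ => ∑ σ : Equiv.Perm ι, ((Equiv.Perm.sign σ : ℤ) : ℝ) *
        ∏ i, NormedSpace.exp (t • M) (σ i) i)
        (∑ σ : Equiv.Perm ι, ((Equiv.Perm.sign σ : ℤ) : ℝ) *
          ∑ i, (∏ j ∈ Finset.univ.erase i, NormedSpace.exp ((0 : ℝ) • M) (σ j) j) • M (σ i) i) 0 := by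
      refine HasDerivAt.fun_sum fun σ _ => HasDerivAt.const_mul _ ?_
      exact HasDerivAt.fun_finsetProd fun i _ => hent (σ i) i
    have h2 : (∑ σ : Equiv.Perm ι, ((Equiv.Perm.sign σ : ℤ) : ℝ) *
          ∑ i, (∏ j ∈ Finset.univ.erase i, NormedSpace.exp ((0 : ℝ) • M) (σ j) j) • M (σ i) i) =
          M.trace := by
      rw [Finset.sum_eq_single 1]
      · simp [Matrix.trace]
      · intro σ _ hσ
        rw [Finset.sum_eq_zero, mul_zero]
        intro i _
        -- A nontrivial permutation moves at least two points, so an off-diagonal entry of the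
        -- identity survives the removal of `i`.
        obtain ⟨j, hj, hji⟩ : ∃ j, σ j ≠ j ∧ j ≠ i := by
          obtain ⟨j, hj⟩ : ∃ j, σ j ≠ j := by
            by_contra! hcon
            exact hσ (Equiv.ext hcon)
          by_cases hji : j = i
          · exact ⟨σ j, fun h => hj (σ.injective h), fun h => hj (h.trans hji.symm)⟩
          · exact ⟨j, hj, hji⟩
        rw [Finset.prod_eq_zero (i := j) (by simp [hji])]
        · simp
        · simp [Matrix.one_apply_ne hj]
      · simp
    rw [h2] at h1
    refine h1.congr_of_eventuallyEq (Eventually.of_forall fun t => ?_)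
    simp [hf, Matrix.det_apply, Units.smul_def]
  have hadd : ∀ s t, f (s + t) = f s * f t := by
    intro s t
    simp only [hf]
    rw [add_smul, Matrix.exp_add_of_commute _ _ (((Commute.refl M).smul_left _).smul_right _),
      det_mul]
  have hd : ∀ t, HasDerivAt f (f t * M.trace) t := by
    intro t
    have h1 : HasDerivAt (fun s => f t * f (s - t)) (f t * M.trace) t := by
      refine HasDerivAt.const_mul _ ?_
      exact HasDerivAt.comp_sub_const t t (by simpa using h0)
    refine h1.congr_of_eventuallyEq (Eventually.of_forall fun s => ?_)
    change f s = f t * f (s - t)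
    rw [← hadd, add_sub_cancel]
  have hg : ∀ t, HasDerivAt (fun t => f t * Real.exp (-(t * M.trace))) 0 t := by
    intro t
    have h1 := (hd t).mul (((hasDerivAt_id t).mul_const M.trace).neg.exp)
    refine HasDerivAt.congr_deriv h1 ?_
    simp only [Pi.neg_apply, id]
    ring
  have hc := is_const_of_deriv_eq_zero (fun t => (hg t).differentiableAt) (fun t => (hg t).deriv)
    t 0
  have hf0 : f 0 = 1 := by simp [hf]
  rw [hf0] at hc
  simp only [zero_mul, neg_zero, Real.exp_zero, mul_one, Real.exp_neg] at hc
  exact (mul_inv_eq_one₀ (Real.exp_pos _).ne').1 hc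

end Uniqueness

/-! ### Unipotent logarithm, Jordan–Chevalley decomposition, logarithm of the modulus. -/

section PolarDecomposition

open Matrix Filter Topology
open scoped Matrix.Norms.Operator Nat

variable {ι : Type*} [Fintype ι] [DecidableEq ι]

theorem exists_exp_neg_eq_of_pow_eq_zero (N : Matrix ι ι ℝ) (m : ℕ) (hN : N ^ (m + 2) = 0) :
    ∃ R : Matrix ι ι ℝ, (∀ Y, Commute N Y → Commute R Y) ∧
      NormedSpace.exp (-N) = 1 - N + N ^ 2 * R := by
  refine ⟨∑ j ∈ Finset.range m, (((j + 2)! : ℝ)⁻¹) • (-N) ^ j, fun Y hY =>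
    Commute.sum_left _ _ _ fun j _ => ((hY.neg_left).pow_left j).smul_left _, ?_⟩
  have h1 : HasSum (fun j : ℕ => ((j ! : ℝ)⁻¹) • (-N) ^ j) (NormedSpace.exp (-N)) :=
    NormedSpace.exp_series_hasSum_exp' (-N)
  have h2 : HasSum (fun j : ℕ => ((j ! : ℝ)⁻¹) • (-N) ^ j)
      (∑ j ∈ Finset.range (m + 2), ((j ! : ℝ)⁻¹) • (-N) ^ j) := by
    refine hasSum_sum_of_ne_finset_zero fun j hj => ?_
    have hj' : m + 2 ≤ j := by simpa using hj
    rw [neg_pow, ← Nat.sub_add_cancel hj', pow_add N, hN]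
    simp
  rw [h1.unique h2, Finset.sum_range_succ', Finset.sum_range_succ', Finset.mul_sum]
  have h3 : ∀ j ∈ Finset.range m, (((j + 1 + 1)! : ℝ)⁻¹) • (-N) ^ (j + 1 + 1) =
      N ^ 2 * ((((j + 2)! : ℝ)⁻¹) • (-N) ^ j) := by
    intro j _
    rw [mul_smul_comm, ← neg_sq N, ← pow_add, add_comm 2 j]
  rw [Finset.sum_congr rfl h3]
  simp
  abel

/-- A unipotent matrix has a nilpotent logarithm commuting with its commutant. -/
theorem exists_isNilpotent_exp_eq_one_add (m : ℕ) (N : Matrix ι ι ℝ) (hN : N ^ m = 0) :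
    ∃ X : Matrix ι ι ℝ, IsNilpotent X ∧ (∀ Y, Commute N Y → Commute X Y) ∧
      NormedSpace.exp X = 1 + N := by
  induction m using Nat.strong_induction_on generalizing N with
  | _ m ih =>
  match m, hN, ih with
  | 0, hN, _ =>
    have : Subsingleton (Matrix ι ι ℝ) := subsingleton_of_zero_eq_one (by simpa using hN.symm)
    exact ⟨0, IsNilpotent.zero, fun Y _ => Commute.zero_left Y, Subsingleton.elim _ _⟩
  | 1, hN, _ =>
    have : N = 0 := by simpa using hN
    exact ⟨0, IsNilpotent.zero, fun Y _ => Commute.zero_left Y, by simp [this]⟩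
  | m + 2, hN, ih =>
    obtain ⟨R, hR, hexp⟩ := exists_exp_neg_eq_of_pow_eq_zero N m hN
    have hNR : Commute N R := (hR N rfl).symm
    -- Multiplying 1 + N by exp(-N) cancels the linear term: (1 - N + N²R)(1 + N) = 1 + N²G. The new
    -- nilpotent part has a smaller exponent, so induction applies.
    set G := R * (1 + N) - 1 with hG
    have hGc : ∀ Y, Commute N Y → Commute G Y := fun Y hY =>
      ((hR Y hY).mul_left ((Commute.one_left Y).add_left hY)).sub_left (Commute.one_left Y)
    have hprod : NormedSpace.exp (-N) * (1 + N) = 1 + N ^ 2 * G := by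
      rw [hexp, hG]
      noncomm_ring
    have hpow : (N ^ 2 * G) ^ (m + 1) = 0 := by
      rw [((hGc N rfl).symm.pow_left 2).mul_pow, ← pow_mul,
        show 2 * (m + 1) = m + 2 + m by ring, pow_add, hN]
      simp
    obtain ⟨X, hX, hXc, hXe⟩ := ih (m + 1) (by omega) _ hpow
    have hXc' : ∀ Y, Commute N Y → Commute X Y := fun Y hY =>
      hXc Y ((hY.pow_left 2).mul_left (hGc Y hY))
    have hNX : Commute N X := (hXc' N rfl).symm
    refine ⟨N + X, hNX.isNilpotent_add ⟨_, hN⟩ hX, fun Y hY => hY.add_left (hXc' Y hY), ?_⟩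
    rw [Matrix.exp_add_of_commute _ _ hNX, hXe, ← hprod, ← mul_assoc, Matrix.exp_neg,
      Matrix.mul_nonsing_inv _ ((Matrix.isUnit_iff_isUnit_det _).1 (Matrix.isUnit_exp N)), one_mul]

theorem eq_zero_of_isNilpotent_mulVec {M : Matrix ι ι ℂ} (hM : IsNilpotent M) {v : ι → ℂ}
    (hv : v ≠ 0) {μ : ℂ} (h : M *ᵥ v = μ • v) : μ = 0 := by
  obtain ⟨k, hk⟩ := hM
  have h1 : ∀ j : ℕ, (M ^ j) *ᵥ v = μ ^ j • v := by
    intro j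
    induction j with
    | zero => simp
    | succ j ih => rw [pow_succ, ← mulVec_mulVec, h, mulVec_smul, ih, smul_smul, pow_succ']
  have h2 := h1 k
  rw [hk, zero_mulVec, eq_comm, smul_eq_zero] at h2
  exact eq_zero_of_pow_eq_zero (h2.resolve_right hv)

/-- Iterated over eigenspaces of commuting matrices, this yields common eigenvectors. -/
theorem exists_eigenvector_mem (M : Matrix ι ι ℂ) (W : Submodule ℂ (ι → ℂ))
    (hW : ∃ w ∈ W, w ≠ 0) (hM : ∀ w ∈ W, M *ᵥ w ∈ W) :
    ∃ μ : ℂ, ∃ v ∈ W, v ≠ 0 ∧ M *ᵥ v = μ • v := by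
  obtain ⟨w, hw, hw0⟩ := hW
  have : Nontrivial W := ⟨⟨⟨w, hw⟩, 0, fun h => hw0 (congrArg Subtype.val h)⟩⟩
  obtain ⟨μ, hμ⟩ := Module.End.exists_eigenvalue
    ((toLin' M).restrict (p := W) (q := W) (fun x hx => by simpa using hM x hx))
  obtain ⟨v, hv⟩ := hμ.exists_hasEigenvector
  refine ⟨μ, v, v.2, fun h => hv.2 (Subtype.ext h), ?_⟩
  simpa using congrArg Subtype.val hv.apply_eq_smul

theorem hasEigenvalue_toLin'_iff (M : Matrix ι ι ℂ) (z : ℂ) :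
    Module.End.HasEigenvalue (toLin' M) z ↔ ∃ v, v ≠ 0 ∧ M *ᵥ v = z • v := by
  constructor
  · intro h
    obtain ⟨v, hv⟩ := h.exists_hasEigenvector
    exact ⟨v, hv.2, by simpa using hv.apply_eq_smul⟩
  · rintro ⟨v, hv, h⟩
    exact Module.End.hasEigenvalue_of_hasEigenvector
      ⟨Module.End.mem_eigenspace_iff.2 (by simpa using h), hv⟩

/-- The Jordan–Chevalley decomposition of a real matrix, with the semisimple part diagonalizable
over the complex numbers. -/
theorem exists_jordanChevalley (A : Matrix ι ι ℝ) :
    ∃ N S : Matrix ι ι ℝ, IsNilpotent N ∧ Commute N S ∧ A = N + S ∧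
      ∀ p : Submodule ℂ (ι → ℂ), (∀ (μ : ℂ) (v : ι → ℂ), complexify S *ᵥ v = μ • v → v ∈ p) → p = ⊤ := by
  have key : ∀ f : Module.End ℝ (ι → ℝ), ∃ n s : Module.End ℝ (ι → ℝ),
      IsNilpotent n ∧ s.IsSemisimple ∧ f = n + s ∧ Commute n s := by
    intro f
    obtain ⟨n, hn, s, hs, hnil, hss, hA⟩ := Module.End.exists_isNilpotent_isSemisimple (f := f)
    have h1 : Commute f n := Algebra.commute_of_mem_adjoin_self hn
    have h2 : s = f - n := by rw [hA]; abel
    exact ⟨n, s, hnil, hss, hA, h2 ▸ h1.symm.sub_right rfl⟩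
  obtain ⟨n, s, hnil, hss, hA, hcomm⟩ := key (toLin' A)
  let e : Matrix ι ι ℝ ≃ₐ[ℝ] Module.End ℝ (ι → ℝ) := Matrix.toLinAlgEquiv'
  refine ⟨e.symm n, e.symm s, hnil.map e.symm, hcomm.map e.symm, ?_, ?_⟩
  · rw [← map_add, ← hA]
    exact (e.symm_apply_apply A).symm
  set S := e.symm s
  set p := minpoly ℝ s
  have hp1 : Polynomial.aeval S p = 0 := by
    rw [Polynomial.aeval_algHom_apply e.symm s p, minpoly.aeval, map_zero]
  have hp2 : Polynomial.aeval (complexify S) (p.map (algebraMap ℝ ℂ)) = 0 := by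
    have hc : (complexify (ι := ι)).comp (algebraMap ℝ (Matrix ι ι ℝ)) =
        (algebraMap ℂ (Matrix ι ι ℂ)).comp (algebraMap ℝ ℂ) := by
      ext r i j
      by_cases hij : i = j <;> simp [Matrix.algebraMap_matrix_apply, hij]
    rw [Polynomial.aeval_def, Polynomial.eval₂_map, ← hc, ← Polynomial.hom_eval₂,
      ← Polynomial.aeval_def, hp1, map_zero]
  have hp3 : Polynomial.aeval (toLin' (complexify S) : Module.End ℂ (ι → ℂ))
      (p.map (algebraMap ℝ ℂ)) = 0 := by
    have := Polynomial.aeval_algHom_apply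
      (Matrix.toLinAlgEquiv' : Matrix ι ι ℂ ≃ₐ[ℂ] Module.End ℂ (ι → ℂ)) (complexify S)
      (p.map (algebraMap ℝ ℂ))
    rw [hp2, map_zero] at this
    exact this
  -- Over the perfect field ℝ squarefree means separable, which survives extension to ℂ.
  have hsq : Squarefree (p.map (algebraMap ℝ ℂ)) :=
    ((PerfectField.separable_iff_squarefree.2 hss.minpoly_squarefree).map).squarefree
  have hsc := Module.End.isSemisimple_of_squarefree_aeval_eq_zero hsq hp3
  intro q hq
  rw [← top_le_iff, ← hsc.iSup_eigenspace_eq_top]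
  refine iSup_le fun μ v hv => hq μ v ?_
  simpa using Module.End.mem_eigenspace_iff.1 hv

/-- The logarithm of the modulus of a diagonalizable real matrix. -/
theorem exists_log_norm (S : Matrix ι ι ℝ)
    (hS : ∀ p : Submodule ℂ (ι → ℂ), (∀ (μ : ℂ) (v : ι → ℂ), complexify S *ᵥ v = μ • v → v ∈ p) → p = ⊤) :
    ∃ H : Matrix ι ι ℝ, (∀ Y, Commute S Y → Commute H Y) ∧
      ∀ (μ : ℂ) (v : ι → ℂ), complexify S *ᵥ v = μ • v →
        complexify H *ᵥ v = ((Real.log ‖μ‖ : ℝ) : ℂ) • v := by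
  let T : Finset ℂ := (complexify S).charpoly.roots.toFinset
  -- Taking H as a polynomial in `S` interpolating log|z| on the spectrum makes it commute with the
  -- commutant of `S`.
  let p : Polynomial ℂ := Lagrange.interpolate T id fun z => ((Real.log ‖z‖ : ℝ) : ℂ)
  let Hc : Matrix ι ι ℂ := Polynomial.aeval (complexify S) p
  have hHc : ∀ (μ : ℂ) (v : ι → ℂ), complexify S *ᵥ v = μ • v → Hc *ᵥ v = ((Real.log ‖μ‖ : ℝ) : ℂ) • v := by
    intro μ v hv
    by_cases hv0 : v = 0
    · simp [hv0]
    have hev : Module.End.HasEigenvalue (toLin' (complexify S)) μ :=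
      (hasEigenvalue_toLin'_iff _ _).2 ⟨v, hv0, hv⟩
    have hT : μ ∈ T := by
      rw [Module.End.hasEigenvalue_iff_isRoot_charpoly, Matrix.charpoly_toLin'] at hev
      rw [Multiset.mem_toFinset, Polynomial.mem_roots (Matrix.charpoly_monic _).ne_zero]
      exact hev
    have h1 := Module.End.aeval_apply_of_hasEigenvector (p := p)
      (f := (toLin' (complexify S) : Module.End ℂ (ι → ℂ))) (μ := μ) (x := v)
      ⟨Module.End.mem_eigenspace_iff.2 (by simpa using hv), hv0⟩
    have h2 := Polynomial.aeval_algHom_apply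
      (Matrix.toLinAlgEquiv' : Matrix ι ι ℂ ≃ₐ[ℂ] Module.End ℂ (ι → ℂ)) (complexify S) p
    have h3 : p.eval μ = ((Real.log ‖μ‖ : ℝ) : ℂ) :=
      Lagrange.eval_interpolate_at_node _ (Set.injOn_id _) hT
    rw [h3] at h1
    rw [← h1]
    exact (congrArg (fun g : Module.End ℂ (ι → ℂ) => g v) h2).symm
  have hconj : ∀ (B : Matrix ι ι ℂ) (v : ι → ℂ),
      (B.map (starRingEnd ℂ)) *ᵥ v = star (B *ᵥ star v) := by
    intro B v
    ext i
    simp [mulVec, dotProduct]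
  -- Conjugation sends μ-eigenvectors of the real matrix `S` to conjugate-μ ones, and log|μ| is
  -- unchanged.
  have hreal : Hc.map (starRingEnd ℂ) = Hc := by
    let W : Submodule ℂ (ι → ℂ) :=
      { carrier := {w | Hc.map (starRingEnd ℂ) *ᵥ w = Hc *ᵥ w}
        add_mem' := fun {a b} ha hb => by
          change _ = _
          rw [mulVec_add, mulVec_add, ha, hb]
        zero_mem' := by simp
        smul_mem' := fun c w hw => by
          change _ = _
          rw [mulVec_smul, mulVec_smul, hw] }
    have hW : W = ⊤ := by
      refine hS W fun μ v hv => ?_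
      change _ = _
      have hS' : (complexify S).map (starRingEnd ℂ) = complexify S := by
        ext i j
        simp
      have h1 : complexify S *ᵥ star v = star μ • star v := by
        rw [← star_smul, ← hv, ← hS', hconj, hS', star_star]
      rw [hconj, hHc _ _ h1, hHc _ _ hv, star_smul, star_star]
      simp
    refine Matrix.ext_of_mulVec_single fun i => ?_
    exact (show Pi.single i 1 ∈ W by rw [hW]; trivial)
  have hHeq : complexify (Hc.map Complex.re) = Hc := by
    ext i j
    have := congrFun (congrFun hreal i) j
    simpa using Complex.conj_eq_iff_re.1 this
  refine ⟨Hc.map Complex.re, fun Y hY => ?_, fun μ v hv => by rw [hHeq, hHc μ v hv]⟩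
  apply complexify_injective
  rw [map_mul, map_mul, hHeq]
  change Commute (Polynomial.aeval (complexify S) p) (complexify Y)
  rw [Polynomial.aeval_eq_sum_range]
  exact Commute.sum_left _ _ _ fun j _ => ((hY.map complexify).pow_left j).smul_left _

end PolarDecomposition

/-! ### Power bounded matrices and the factorization exp(L) U. -/

section PowerBounded

open Matrix Filter Topology
open scoped Matrix.Norms.Operator Nat

variable {ι : Type*} [Fintype ι] [DecidableEq ι]

theorem complexify_zpow_mulVec (U : Matrix ι ι ℝ) (hU : IsUnit U.det) {c : ℂ} (hc : c ≠ 0)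
    {v : ι → ℂ} (h : complexify U *ᵥ v = c • v) (k : ℤ) :
    complexify (U ^ k) *ᵥ v = c ^ k • v := by
  have hinv : complexify U⁻¹ *ᵥ v = c⁻¹ • v := by
    have h1 : v = c⁻¹ • (complexify U *ᵥ v) := by rw [h, smul_smul, inv_mul_cancel₀ hc, one_smul]
    conv_lhs => rw [h1]
    rw [mulVec_smul, mulVec_mulVec, ← map_mul, Matrix.nonsing_inv_mul _ hU, map_one, one_mulVec]
  induction k using Int.induction_on with
  | zero => simp
  | succ k ih =>
    rw [Matrix.zpow_add_one hU, map_mul, ← mulVec_mulVec, h, mulVec_smul, ih, smul_smul,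
      zpow_add_one₀ hc, mul_comm]
  | pred k ih =>
    rw [Matrix.zpow_sub_one hU, map_mul, ← mulVec_mulVec, hinv, mulVec_smul, ih, smul_smul,
      zpow_sub_one₀ hc, mul_comm]

theorem linfty_opNorm_le_sum_col (M : Matrix ι ι ℝ) :
    ‖M‖ ≤ ∑ j, ‖complexify M *ᵥ (Pi.single j 1 : ι → ℂ)‖ := by
  have h : ∀ i, ∑ j, ‖M i j‖₊ ≤ ∑ j, ‖complexify M *ᵥ (Pi.single j 1 : ι → ℂ)‖₊ := fun i => by
    refine Finset.sum_le_sum fun j _ => ?_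
    have := nnnorm_le_pi_nnnorm (complexify M *ᵥ (Pi.single j 1 : ι → ℂ)) i
    simpa using this
  rw [linfty_opNorm_def]
  have h1 := Finset.sup_le (s := Finset.univ) fun i _ => h i
  refine (NNReal.coe_le_coe.2 h1).trans (le_of_eq ?_)
  push_cast
  rfl

/-- A diagonalizable matrix with eigenvalues on the unit circle is power bounded. -/
theorem zpow_bounded_of_eigenvalues_norm_one (U : Matrix ι ι ℝ) (hU : IsUnit U.det)
    (h : ∀ p : Submodule ℂ (ι → ℂ),
      (∀ (c : ℂ) (v : ι → ℂ), ‖c‖ = 1 → complexify U *ᵥ v = c • v → v ∈ p) → p = ⊤) :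
    ∃ C : ℝ, ∀ k : ℤ, ‖U ^ k‖ ≤ C := by
  let W : Submodule ℂ (ι → ℂ) :=
    { carrier := {w | ∃ C : ℝ, ∀ k : ℤ, ‖complexify (U ^ k) *ᵥ w‖ ≤ C}
      add_mem' := by
        rintro a b ⟨C, hC⟩ ⟨D, hD⟩
        refine ⟨C + D, fun k => ?_⟩
        rw [mulVec_add]
        exact (norm_add_le _ _).trans (add_le_add (hC k) (hD k))
      zero_mem' := ⟨0, by simp⟩
      smul_mem' := by
        rintro c w ⟨C, hC⟩
        refine ⟨‖c‖ * C, fun k => ?_⟩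
        rw [mulVec_smul, norm_smul]
        gcongr
        exact hC k }
  have hW : W = ⊤ := by
    refine h W fun c v hc hv => ⟨‖v‖, fun k => ?_⟩
    have hc0 : c ≠ 0 := by
      rintro rfl
      simp at hc
    rw [complexify_zpow_mulVec U hU hc0 hv, norm_smul, norm_zpow, hc]
    simp
  have hb : ∀ j, ∃ C : ℝ, ∀ k : ℤ, ‖complexify (U ^ k) *ᵥ (Pi.single j 1 : ι → ℂ)‖ ≤ C :=
    fun j => show Pi.single j 1 ∈ W by rw [hW]; trivial
  choose C hC using hb
  exact ⟨∑ j, C j, fun k => (linfty_opNorm_le_sum_col _).trans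
    (Finset.sum_le_sum fun j _ => hC j k)⟩

/-- Bounded entries bound all powers of |det U|, positive and negative. -/
theorem abs_det_eq_one_of_zpow_bounded (U : Matrix ι ι ℝ) (hU : IsUnit U.det)
    (C : ℝ) (h : ∀ k : ℤ, ‖U ^ k‖ ≤ C) : |U.det| = 1 := by
  have hent : ∀ k i j, |(U ^ (k : ℤ)) i j| ≤ C := by
    intro k i j
    have h1 : ‖(U ^ k) *ᵥ (Pi.single j 1 : ι → ℝ)‖ ≤ ‖U ^ k‖ * ‖(Pi.single j 1 : ι → ℝ)‖ :=
      linfty_opNorm_mulVec _ _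
    have h2 := norm_le_pi_norm ((U ^ k) *ᵥ (Pi.single j 1 : ι → ℝ)) i
    have h3 : ‖(Pi.single j 1 : ι → ℝ)‖ ≤ 1 := by simp [Pi.norm_single]
    simp only [mulVec_single_one, col_apply, Real.norm_eq_abs] at h1 h2
    nlinarith [h k, norm_nonneg (U ^ k)]
  have hdet : ∀ k : ℤ, |U.det| ^ k ≤ (Fintype.card ι)! • C ^ Fintype.card ι := by
    intro k
    have h1 := Matrix.det_le (A := U ^ k) (abv := AbsoluteValue.abs) (x := C)
      (fun i j => hent k i j)
    have h2 : (U ^ k).det = U.det ^ k := by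
      cases k with
      | ofNat k => simp [Matrix.det_pow]
      | negSucc k =>
        rw [_root_.zpow_negSucc, _root_.zpow_negSucc, Matrix.det_nonsing_inv, Matrix.det_pow,
          Ring.inverse_eq_inv']
    rw [h2] at h1
    rw [← abs_zpow]
    exact h1
  have hpos : 0 < |U.det| := abs_pos.2 hU.ne_zero
  apply le_antisymm
  · by_contra! hlt
    obtain ⟨k, hk⟩ := pow_unbounded_of_one_lt ((Fintype.card ι)! • C ^ Fintype.card ι) hlt
    have := hdet k
    rw [zpow_natCast] at this
    linarith
  · by_contra! hlt
    obtain ⟨k, hk⟩ := pow_unbounded_of_one_lt ((Fintype.card ι)! • C ^ Fintype.card ι)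
      ((one_lt_inv₀ hpos).2 hlt)
    have := hdet (-k)
    rw [_root_.zpow_neg, zpow_natCast, ← inv_pow] at this
    linarith

theorem isUnit_det_of_eigenvalues_ne_zero (A : Matrix ι ι ℝ)
    (hA : ∀ z : ℂ, Module.End.HasEigenvalue (toLin' (complexify A)) z → z ≠ 0) :
    IsUnit A.det := by
  rw [isUnit_iff_ne_zero]
  intro h0
  obtain ⟨v, hv, hAv⟩ := Matrix.exists_mulVec_eq_zero_iff.2 h0
  refine hA 0 ((hasEigenvalue_toLin'_iff _ _).2 ⟨fun i => (v i : ℂ), ?_, ?_⟩) rfl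
  · intro h
    apply hv
    ext i
    simpa using congrFun h i
  · rw [complexify_mulVec, hAv]
    ext
    simp

/-- Multiplicative polar decomposition of a dilation: `A = exp L * U` with `L` having real positive
spectrum and `U` power bounded, commuting with `L`. -/
theorem exists_exp_mul_zpow_bounded (A : Matrix ι ι ℝ)
    (hA : ∀ z : ℂ, Module.End.HasEigenvalue (toLin' (complexify A)) z → 1 < ‖z‖) :
    ∃ L U : Matrix ι ι ℝ, Commute L U ∧ A = NormedSpace.exp L * U ∧ IsUnit U.det ∧
      (∃ C : ℝ, ∀ k : ℤ, ‖U ^ k‖ ≤ C) ∧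
      ∀ z : ℂ, Module.End.HasEigenvalue (toLin' (complexify L)) z → z.im = 0 ∧ 0 < z.re := by
  have hAu : IsUnit A.det := isUnit_det_of_eigenvalues_ne_zero A fun z hz h0 => by
    have := hA z hz
    rw [h0, norm_zero] at this
    linarith
  obtain ⟨N, S, hN, hNS, hANS, hS⟩ := exists_jordanChevalley A
  obtain ⟨H, hH, hHv⟩ := exists_log_norm S hS
  have hSunit : IsUnit S := by
    have h1 : IsUnit (N + S) := hANS ▸ (Matrix.isUnit_iff_isUnit_det A).2 hAu
    have h2 : S = N + S + -N := by abel
    rw [h2]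
    exact hN.neg.isUnit_add_left_of_commute h1 (((Commute.refl N).add_right hNS).neg_left)
  have hSu : IsUnit S.det := (Matrix.isUnit_iff_isUnit_det S).1 hSunit
  have hinv : ∀ Y, Commute S Y → Commute S⁻¹ Y := fun Y hY => by
    simpa using Matrix.Commute.zpow_left hY (-1)
  -- A = S(1 + S⁻¹N). With exp X = 1 + S⁻¹N and H the log-modulus of `S`, the factors are L = H + X
  -- and U = exp(-H) S.
  have hN0 : IsNilpotent (S⁻¹ * N) := (hinv N hNS.symm).isNilpotent_mul_left hN
  obtain ⟨m, hm⟩ := hN0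
  obtain ⟨X, hX, hXc, hXe⟩ := exists_isNilpotent_exp_eq_one_add m _ hm
  have hXY : ∀ Y, Commute S Y → Commute N Y → Commute X Y := fun Y h1 h2 =>
    hXc Y ((hinv Y h1).mul_left h2)
  have hXS : Commute X S := hXY S rfl hNS
  have hHX : Commute H X := hH X hXS.symm
  have hHS : Commute H S := hH S rfl
  have hexpHS : Commute (NormedSpace.exp (-H)) S := (hHS.neg_left).exp_left
  have hHunit : IsUnit (NormedSpace.exp H).det :=
    (Matrix.isUnit_iff_isUnit_det _).1 (Matrix.isUnit_exp H)
  have hLU : Commute (H + X) (NormedSpace.exp (-H) * S) :=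
    Commute.mul_right (((Commute.refl H).add_left hHX.symm).neg_right.exp_right)
      (hHS.add_left hXS)
  have hUdet : IsUnit (NormedSpace.exp (-H) * S).det := by
    rw [det_mul]
    exact ((Matrix.isUnit_iff_isUnit_det _).1 (Matrix.isUnit_exp (-H))).mul hSu
  refine ⟨H + X, NormedSpace.exp (-H) * S, hLU, ?_, hUdet, ?_, ?_⟩
  · rw [add_comm, Matrix.exp_add_of_commute _ _ hHX.symm, mul_assoc, ← mul_assoc (NormedSpace.exp H),
      Matrix.exp_neg, Matrix.mul_nonsing_inv _ hHunit, one_mul, hXe, add_mul, one_mul,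
      (hinv N hNS.symm).eq, mul_assoc, Matrix.nonsing_inv_mul _ hSu, mul_one, hANS, add_comm]
  · refine zpow_bounded_of_eigenvalues_norm_one _ hUdet fun p hp => hS p fun μ v hv => ?_
    by_cases hv0 : v = 0
    · simp [hv0]
    have hμ : μ ≠ 0 := by
      rintro rfl
      apply hv0
      have := congrArg (fun w => complexify S⁻¹ *ᵥ w) hv
      simpa only [mulVec_mulVec, ← map_mul, Matrix.nonsing_inv_mul _ hSu, map_one, one_mulVec,
        zero_smul, mulVec_zero] using this
    have hn : 0 < ‖μ‖ := norm_pos_iff.2 hμ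
    -- exp(-H) divides the eigenvalue μ of `S` by its modulus.
    refine hp ((‖μ‖⁻¹ : ℝ) * μ) v ?_ ?_
    · rw [norm_mul, Complex.norm_real, norm_inv, norm_norm, inv_mul_cancel₀ hn.ne']
    · have h1 := exp_smul_mulVec_eq (complexify H) (Real.log ‖μ‖ : ℝ) v 1
        (by rw [pow_one, sub_mulVec, hHv μ v hv, smul_mulVec, one_mulVec, sub_self]) (-1)
      rw [neg_one_smul, ← map_neg, ← complexify_exp] at h1
      rw [map_mul, ← mulVec_mulVec, hv, mulVec_smul, h1]
      have h2 : Complex.exp (-1 * ((Real.log ‖μ‖ : ℝ) : ℂ)) = (‖μ‖⁻¹ : ℝ) := by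
        rw [← Complex.ofReal_one, ← Complex.ofReal_neg, ← Complex.ofReal_mul, ← Complex.ofReal_exp,
          neg_one_mul, Real.exp_neg, Real.exp_log hn]
      rw [h2]
      simp [smul_smul, mul_comm]
  · intro z hz
    obtain ⟨v₀, hv₀, hLv₀⟩ := (hasEigenvalue_toLin'_iff _ _).1 hz
    have hcomm : ∀ {B D : Matrix ι ι ℝ} (w : ι → ℂ) (c : ℂ), Commute B D →
        complexify B *ᵥ w = c • w → complexify B *ᵥ (complexify D *ᵥ w) =
          c • (complexify D *ᵥ w) := by
      intro B D w c hBD hw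
      rw [mulVec_mulVec, ← map_mul, hBD.eq, map_mul, ← mulVec_mulVec, hw, mulVec_smul]
    let E : Matrix ι ι ℝ → ℂ → Submodule ℂ (ι → ℂ) := fun B c =>
      { carrier := {w | complexify B *ᵥ w = c • w}
        add_mem' := fun {a b} ha hb => by
          change _ = _
          rw [mulVec_add, ha, hb, smul_add]
        zero_mem' := by simp
        smul_mem' := fun d w hw => by
          change _ = _
          rw [mulVec_smul, hw, smul_comm] }
    have hLS : Commute (H + X) S := hHS.add_left hXS
    have hLN : Commute (H + X) N := (hH N hNS.symm).add_left (hXY N hNS.symm rfl)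
    -- A common eigenvector of L, `S` and `N` is sought: the nilpotent `N` and `X` act on it by 0,
    -- which forces z = log|μ| with μ an eigenvalue of `A`.
    obtain ⟨μ, v₁, hv₁, hv₁0, hSv₁⟩ := exists_eigenvector_mem (complexify S) (E (H + X) z)
      ⟨v₀, hLv₀, hv₀⟩ fun w hw => hcomm w z hLS hw
    obtain ⟨ν, v, hv, hv0, hNv⟩ := exists_eigenvector_mem (complexify N) (E (H + X) z ⊓ E S μ)
      ⟨v₁, ⟨hv₁, hSv₁⟩, hv₁0⟩ fun w hw => ⟨hcomm w z hLN hw.1, hcomm w μ hNS.symm hw.2⟩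
    have hLv : complexify (H + X) *ᵥ v = z • v := hv.1
    have hSv : complexify S *ᵥ v = μ • v := hv.2
    have hν := eq_zero_of_isNilpotent_mulVec (hN.map complexify) hv0 hNv
    have hAv : complexify A *ᵥ v = μ • v := by
      rw [hANS, map_add, add_mulVec, hNv, hSv, hν, zero_smul, zero_add]
    have hμ := hA μ ((hasEigenvalue_toLin'_iff _ _).2 ⟨v, hv0, hAv⟩)
    have hXv : complexify X *ᵥ v = (z - (Real.log ‖μ‖ : ℝ)) • v := by
      rw [map_add, add_mulVec, hHv μ v hSv] at hLv
      rw [sub_smul, ← hLv]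
      abel
    have hz' := sub_eq_zero.1 (eq_zero_of_isNilpotent_mulVec (hX.map complexify) hv0 hXv)
    rw [hz']
    exact ⟨Complex.ofReal_im _, by simpa using Real.log_pos hμ⟩

end PowerBounded

/-! ### Equivalence of all quasi-norms of one dilation. -/

section QuasiNorms

open Matrix Filter Topology MeasureTheory
open scoped Matrix.Norms.Operator Nat

variable {n : ℕ}

theorem tendsto_inv_pow_of_exp_mul {A L U : Matrix (Fin n) (Fin n) ℝ} (hLU : Commute L U)
    (hA : A = NormedSpace.exp L * U) (hC : ∃ C : ℝ, ∀ k : ℤ, ‖U ^ k‖ ≤ C)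
    (hL : Tendsto (fun s : ℝ => NormedSpace.exp ((-s) • L)) atTop (𝓝 0)) :
    Tendsto (fun k : ℕ => A⁻¹ ^ k) atTop (𝓝 0) := by
  obtain ⟨C, hC⟩ := hC
  have h1 : ∀ k : ℕ, A⁻¹ ^ k = U ^ (-k : ℤ) * NormedSpace.exp ((-(k : ℝ)) • L) := by
    intro k
    have h2 : NormedSpace.exp ((-(k : ℝ)) • L) = (NormedSpace.exp L ^ k)⁻¹ := by
      rw [neg_smul, Matrix.exp_neg, ← Matrix.exp_nsmul, Nat.cast_smul_eq_nsmul]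
    rw [Matrix.inv_pow', hA, hLU.exp_left.mul_pow, Matrix.mul_inv_rev, h2,
      Matrix.zpow_neg_natCast]
  have hL' := tendsto_zero_iff_norm_tendsto_zero.1 hL
  refine tendsto_zero_iff_norm_tendsto_zero.2 ?_
  have h3 : Tendsto (fun k : ℕ => C * ‖NormedSpace.exp ((-(k : ℝ)) • L)‖) atTop (𝓝 0) := by
    simpa using (hL'.comp tendsto_natCast_atTop_atTop).const_mul C
  refine squeeze_zero (fun k => norm_nonneg _) (fun k => ?_) h3
  rw [h1]
  exact (norm_mul_le _ _).trans (mul_le_mul_of_nonneg_right (hC _) (norm_nonneg _))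

/-- The determinants of the inverse powers tend to det 0, which is 0 because n ≥ 1; for n = 0 every
determinant is 1. -/
theorem one_lt_abs_det_of_tendsto [NeZero n] {A : Matrix (Fin n) (Fin n) ℝ} (hA : IsUnit A.det)
    (h : Tendsto (fun k : ℕ => A⁻¹ ^ k) atTop (𝓝 0)) : 1 < |A.det| := by
  have h1 : Tendsto (fun k : ℕ => (A⁻¹ ^ k).det) atTop (𝓝 0) := by
    have h2 : Continuous fun M : Matrix (Fin n) (Fin n) ℝ => M.det := continuous_id.matrix_det
    have := (h2.tendsto 0).comp h
    rwa [Matrix.det_zero] at this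
  by_contra! hle
  have hpos : 0 < |A.det| := abs_pos.2 hA.ne_zero
  obtain ⟨k, hk⟩ := ((h1.abs).eventually_lt_const (u := 1) (by simp)).exists
  rw [Matrix.det_pow, Matrix.det_nonsing_inv, Ring.inverse_eq_inv', abs_pow, abs_inv] at hk
  exact absurd hk (not_lt.2 (one_le_pow₀ ((one_le_inv₀ hpos).2 hle)))

/-- What is used about a dilation: its inverse powers decay and it expands volume. -/
structure IsExpansive (A : Matrix (Fin n) (Fin n) ℝ) : Prop where
  isUnit_det : IsUnit A.det
  tendsto : Tendsto (fun k : ℕ => A⁻¹ ^ k) atTop (𝓝 0)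
  one_lt_det : 1 < |A.det|

theorem IsAnisotropicDilation.isExpansive [NeZero n] {A : Matrix (Fin n) (Fin n) ℝ}
    (hA : IsAnisotropicDilation A) : IsExpansive A := by
  obtain ⟨L, U, hLU, hA', hU, hC, hL⟩ := exists_exp_mul_zpow_bounded A hA
  have hu : IsUnit A.det := by
    rw [hA', det_mul]
    exact ((Matrix.isUnit_iff_isUnit_det _).1 (Matrix.isUnit_exp L)).mul hU
  have ht := tendsto_inv_pow_of_exp_mul hLU hA' hC
    (tendsto_exp_neg_smul_zero L fun z hz => (hL z hz).2)
  exact ⟨hu, ht, one_lt_abs_det_of_tendsto hu ht⟩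

namespace IsAssociatedQuasiNorm

variable {A : Matrix (Fin n) (Fin n) ℝ} {ρ ρ' : (Fin n → ℝ) → ℝ≥0}

theorem exists_one_le_quasi_triangle (h : IsAssociatedQuasiNorm A ρ) :
    ∃ c : ℝ, 1 ≤ c ∧ ∀ x y, (ρ (x + y) : ℝ) ≤ c * (ρ x + ρ y) := by
  obtain ⟨c, hc⟩ := h.quasi_triangle
  exact ⟨max c 1, le_max_right _ _, fun x y => (hc x y).trans
    (mul_le_mul_of_nonneg_right (le_max_left _ _) (by positivity))⟩

theorem pow_mulVec (h : IsAssociatedQuasiNorm A ρ) (k : ℕ) (x : Fin n → ℝ) :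
    (ρ ((A ^ k) *ᵥ x) : ℝ) = |A.det| ^ k * ρ x := by
  induction k with
  | zero => simp
  | succ k ih => rw [pow_succ', ← mulVec_mulVec, h.homogeneous, ih, pow_succ', mul_assoc]

theorem inv_pow_mulVec (h : IsAssociatedQuasiNorm A ρ) (hA : IsExpansive A) (k : ℕ)
    (x : Fin n → ℝ) : (ρ (x) : ℝ) = |A.det| ^ k * ρ ((A⁻¹ ^ k) *ᵥ x) := by
  rw [← h.pow_mulVec, mulVec_mulVec, Matrix.inv_pow', Matrix.mul_nonsing_inv, one_mulVec]
  rw [det_pow]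
  exact hA.isUnit_det.pow k

theorem zpow_mulVec (h : IsAssociatedQuasiNorm A ρ) (hA : IsExpansive A) (k : ℤ)
    (x : Fin n → ℝ) : (ρ ((A ^ k) *ᵥ x) : ℝ) = |A.det| ^ k * ρ x := by
  have hd : |A.det| ≠ 0 := (zero_lt_one.trans hA.one_lt_det).ne'
  obtain ⟨k, rfl | rfl⟩ := k.eq_nat_or_neg
  · rw [zpow_natCast, zpow_natCast, h.pow_mulVec]
  · rw [Matrix.zpow_neg_natCast, ← Matrix.inv_pow', h.inv_pow_mulVec hA k x, _root_.zpow_neg,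
      zpow_natCast, inv_mul_cancel_left₀ (pow_ne_zero k hd)]

/-- A quasi-norm is bounded near the origin, by Steinhaus' theorem. -/
theorem exists_bound_near_zero (h : IsAssociatedQuasiNorm A ρ) :
    ∃ r M : ℝ, 0 < r ∧ ∀ x, ‖x‖ < r → (ρ x : ℝ) ≤ M := by
  obtain ⟨c, hc1, hc⟩ := h.exists_one_le_quasi_triangle
  -- Both ρ x and ρ (-x) are bounded since ρ need not be even and the difference set a - b is
  -- estimated as a + (-b).
  let E : ℕ → Set (Fin n → ℝ) := fun N => {x | ρ x ≤ N} ∩ {x | ρ (-x) ≤ N}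
  have hE : ∀ N, NullMeasurableSet (E N) := by
    intro N
    have h1 : NullMeasurableSet {x | ρ x ≤ N} (volume : Measure (Fin n → ℝ)) :=
      h.measurable measurableSet_Iic
    exact h1.inter (h1.preimage
      (Measure.measurePreserving_neg (volume : Measure (Fin n → ℝ))).quasiMeasurePreserving)
  obtain ⟨N, hN⟩ : ∃ N, 0 < (volume : Measure (Fin n → ℝ)) (E N) := by
    by_contra! hcon
    have h0 : (volume : Measure (Fin n → ℝ)) (⋃ N, E N) = 0 :=
      measure_iUnion_null fun N => le_antisymm (hcon N) zero_le
    have h1 : ⋃ N, E N = Set.univ := by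
      refine Set.eq_univ_of_forall fun x => Set.mem_iUnion.2 ?_
      obtain ⟨N, hN⟩ := exists_nat_ge (max (ρ x) (ρ (-x)))
      exact ⟨N, (le_max_left _ _).trans hN, (le_max_right _ _).trans hN⟩
    rw [h1] at h0
    exact (NeZero.ne _) (Measure.measure_univ_eq_zero.1 h0)
  obtain ⟨F, hFE, hF, hFae⟩ := (hE N).exists_measurable_subset_ae_eq
  rw [← measure_congr hFae] at hN
  have h2 := Measure.sub_mem_nhds_zero_of_addHaar_pos (volume : Measure (Fin n → ℝ)) F hF hN
  obtain ⟨r, hr, hball⟩ := Metric.mem_nhds_iff.1 h2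
  refine ⟨r, c * (N + N), hr, fun x hx => ?_⟩
  obtain ⟨a, ha, b, hb, rfl⟩ := Set.mem_sub.1 (hball (mem_ball_zero_iff.2 hx))
  have ha' : (ρ a : ℝ) ≤ N := by exact_mod_cast (hFE ha).1
  have hb' : (ρ (-b) : ℝ) ≤ N := by exact_mod_cast (hFE hb).2
  rw [sub_eq_add_neg]
  exact (hc _ _).trans (mul_le_mul_of_nonneg_left (add_le_add ha' hb') (by linarith))

theorem exists_forall_lt_of_norm_lt (h : IsAssociatedQuasiNorm A ρ) (hA : IsExpansive A)
    {ε : ℝ} (hε : 0 < ε) : ∃ δ : ℝ, 0 < δ ∧ ∀ x, ‖x‖ < δ → (ρ x : ℝ) < ε := by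
  obtain ⟨r, M, hr, hM⟩ := h.exists_bound_near_zero
  obtain ⟨k, hk⟩ := pow_unbounded_of_one_lt (M / ε) hA.one_lt_det
  have hd : 0 < |A.det| ^ k := pow_pos (zero_lt_one.trans hA.one_lt_det) k
  refine ⟨r / (‖A ^ k‖ + 1), by positivity, fun x hx => ?_⟩
  have h1 : ‖(A ^ k) *ᵥ x‖ < r := by
    refine (linfty_opNorm_mulVec _ _).trans_lt ?_
    rw [lt_div_iff₀ (by positivity)] at hx
    nlinarith [norm_nonneg x]
  have h2 := hM _ h1
  rw [h.pow_mulVec] at h2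
  rw [div_lt_iff₀ hε] at hk
  exact lt_of_mul_lt_mul_left (h2.trans_lt hk) hd.le

theorem exists_bound_of_norm_le (h : IsAssociatedQuasiNorm A ρ) (hA : IsExpansive A) (R : ℝ) :
    ∃ M : ℝ, ∀ x, ‖x‖ ≤ R → (ρ x : ℝ) ≤ M := by
  obtain ⟨r, M, hr, hM⟩ := h.exists_bound_near_zero
  have h1 : Tendsto (fun k : ℕ => ‖A⁻¹ ^ k‖ * R) atTop (𝓝 0) := by
    simpa using (hA.tendsto.norm).mul_const R
  obtain ⟨k, hk⟩ := (h1.eventually_lt_const hr).exists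
  refine ⟨|A.det| ^ k * M, fun x hx => ?_⟩
  rw [h.inv_pow_mulVec hA k x]
  refine mul_le_mul_of_nonneg_left (hM _ ?_) (by positivity)
  exact ((linfty_opNorm_mulVec _ _).trans (mul_le_mul_of_nonneg_left hx (norm_nonneg _))).trans_lt hk

/-- No continuity of ρ is available; near x, the quasi-triangle inequality and smallness of ρ (x -
y) give ρ y ≥ ρ x / (2c), and compactness does the rest. -/
theorem exists_pos_le_of_isCompact (h : IsAssociatedQuasiNorm A ρ) (hA : IsExpansive A)
    {K : Set (Fin n → ℝ)} (hK : IsCompact K) (h0 : (0 : Fin n → ℝ) ∉ K) :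
    ∃ η : ℝ, 0 < η ∧ ∀ x ∈ K, η ≤ (ρ x : ℝ) := by
  obtain ⟨c, hc1, hc⟩ := h.exists_one_le_quasi_triangle
  refine hK.induction_on (p := fun s => ∃ η : ℝ, 0 < η ∧ ∀ x ∈ s, η ≤ (ρ x : ℝ))
    ⟨1, one_pos, by simp⟩ ?_ ?_ ?_
  · rintro s t hst ⟨η, hη, ht⟩
    exact ⟨η, hη, fun x hx => ht x (hst hx)⟩
  · rintro s t ⟨η, hη, hs⟩ ⟨η', hη', ht⟩
    refine ⟨min η η', lt_min hη hη', fun x hx => ?_⟩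
    rcases hx with hx | hx
    · exact (min_le_left _ _).trans (hs x hx)
    · exact (min_le_right _ _).trans (ht x hx)
  · intro x hx
    have hx0 : x ≠ 0 := fun hx' => h0 (hx' ▸ hx)
    have hρ : 0 < (ρ x : ℝ) := by
      have : ρ x ≠ 0 := fun h' => hx0 ((h.eq_zero_iff x).1 h')
      exact_mod_cast pos_iff_ne_zero.2 this
    have hc0 : 0 < c := by linarith
    obtain ⟨δ, hδ, hδ'⟩ := h.exists_forall_lt_of_norm_lt hA (ε := ρ x / (2 * c)) (by positivity)
    refine ⟨Metric.ball x δ, mem_nhdsWithin_of_mem_nhds (Metric.ball_mem_nhds x hδ),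
      ρ x / (2 * c), by positivity, fun y hy => ?_⟩
    have h1 := hδ' (x - y) (by rwa [← dist_eq_norm, dist_comm])
    have h2 := hc y (x - y)
    rw [add_sub_cancel] at h2
    have h3 : (ρ x : ℝ) = c * (2 * (ρ x / (2 * c))) := by field_simp
    have h4 : c * (2 * (ρ x / (2 * c))) ≤ c * (ρ y + ρ (x - y)) := h3 ▸ h2
    have h5 := le_of_mul_le_mul_left h4 hc0
    linarith

theorem exists_pos_le_of_one_lt_norm (h : IsAssociatedQuasiNorm A ρ) (hA : IsExpansive A) :
    ∃ η : ℝ, 0 < η ∧ ∀ x : Fin n → ℝ, 1 < ‖x‖ → η ≤ (ρ x : ℝ) := by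
  -- Just before the backward orbit first enters the unit ball, its point lies in this shell;
  -- returning to x only increases ρ.
  let K : Set (Fin n → ℝ) := Metric.closedBall 0 ‖A‖ ∩ {x | 1 ≤ ‖x‖}
  have hK : IsCompact K := (isCompact_closedBall _ _).inter_right
    (isClosed_le continuous_const continuous_norm)
  obtain ⟨η, hη, hKη⟩ := h.exists_pos_le_of_isCompact hA hK (by simp [K])
  refine ⟨η, hη, fun x hx => ?_⟩
  have h1 : Tendsto (fun k : ℕ => (A⁻¹ ^ k) *ᵥ x) atTop (𝓝 0) := by
    have := ((continuous_id.matrix_mulVec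
      (continuous_const (y := x))).tendsto (0 : Matrix (Fin n) (Fin n) ℝ)).comp hA.tendsto
    simpa [Function.comp_def] using this
  have hex : ∃ k : ℕ, ‖(A⁻¹ ^ k) *ᵥ x‖ ≤ 1 :=
    ((h1.norm.eventually_lt_const (u := 1) (by simp)).exists).imp fun _ hk => hk.le
  classical
  set k := Nat.find hex with hk
  have hk1 := Nat.find_spec hex
  have hk0 : k ≠ 0 := by
    intro hk0
    rw [← hk, hk0, pow_zero, one_mulVec] at hk1
    linarith
  obtain ⟨j, hj⟩ := Nat.exists_eq_succ_of_ne_zero hk0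
  have hj1 : 1 < ‖(A⁻¹ ^ j) *ᵥ x‖ := not_le.1 (Nat.find_min hex (m := j) (by omega))
  have hmem : (A⁻¹ ^ j) *ᵥ x ∈ K := by
    refine ⟨?_, hj1.le⟩
    rw [mem_closedBall_zero_iff]
    rw [← hk, hj] at hk1
    have h2 : (A⁻¹ ^ j) *ᵥ x = A *ᵥ ((A⁻¹ ^ (j + 1)) *ᵥ x) := by
      rw [mulVec_mulVec, pow_succ', ← mul_assoc, Matrix.mul_nonsing_inv _ hA.isUnit_det, one_mul]
    rw [h2]
    refine (linfty_opNorm_mulVec _ _).trans ?_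
    simpa using mul_le_mul_of_nonneg_left hk1 (norm_nonneg A)
  have h3 := hKη _ hmem
  rw [h.inv_pow_mulVec hA j x]
  have h4 : 1 ≤ |A.det| ^ j := one_le_pow₀ hA.one_lt_det.le
  nlinarith

theorem exists_norm_le_of_le (h : IsAssociatedQuasiNorm A ρ) (hA : IsExpansive A) (T : ℝ) :
    ∃ R : ℝ, ∀ x : Fin n → ℝ, (ρ x : ℝ) ≤ T → ‖x‖ ≤ R := by
  obtain ⟨η, hη, hη'⟩ := h.exists_pos_le_of_one_lt_norm hA
  obtain ⟨k, hk⟩ := pow_unbounded_of_one_lt (T / η) hA.one_lt_det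
  have hd : 0 < |A.det| ^ k := pow_pos (zero_lt_one.trans hA.one_lt_det) k
  refine ⟨‖A ^ k‖, fun x hx => ?_⟩
  have h1 : ‖(A⁻¹ ^ k) *ᵥ x‖ ≤ 1 := by
    by_contra! hlt
    have h2 := hη' _ hlt
    rw [h.inv_pow_mulVec hA k x] at hx
    rw [div_lt_iff₀ hη] at hk
    nlinarith [mul_le_mul_of_nonneg_left h2 hd.le]
  have h3 : x = (A ^ k) *ᵥ ((A⁻¹ ^ k) *ᵥ x) := by
    rw [mulVec_mulVec, Matrix.inv_pow', Matrix.mul_nonsing_inv, one_mulVec]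
    rw [det_pow]
    exact hA.isUnit_det.pow k
  rw [h3]
  refine (linfty_opNorm_mulVec _ _).trans ?_
  simpa using mul_le_mul_of_nonneg_left h1 (norm_nonneg (A ^ k))

theorem exists_le_mul (h : IsAssociatedQuasiNorm A ρ) (h' : IsAssociatedQuasiNorm A ρ')
    (hA : IsExpansive A) : ∃ C : ℝ, 0 < C ∧ ∀ x, (ρ' x : ℝ) ≤ C * ρ x := by
  obtain ⟨R, hR⟩ := h.exists_norm_le_of_le hA |A.det|
  obtain ⟨M, hM⟩ := h'.exists_bound_of_norm_le hA R
  refine ⟨max M 1, by positivity, fun x => ?_⟩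
  by_cases hx : x = 0
  · have h1 := (h.eq_zero_iff x).2 hx
    have h2 := (h'.eq_zero_iff x).2 hx
    simp [h1, h2]
  have hρ : 0 < (ρ x : ℝ) := by
    have : ρ x ≠ 0 := fun h' => hx ((h.eq_zero_iff x).1 h')
    exact_mod_cast pos_iff_ne_zero.2 this
  have hd0 : 0 < |A.det| := zero_lt_one.trans hA.one_lt_det
  -- Scaling by A^(-k) brings ρ x into [1, |det A|), where ρ' is bounded.
  obtain ⟨k, hk1, hk2⟩ := exists_mem_Ico_zpow hρ hA.one_lt_det
  have hdk : 0 < |A.det| ^ k := zpow_pos hd0 k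
  have h1 := h.zpow_mulVec hA (-k) x
  have h2 := h'.zpow_mulVec hA (-k) x
  rw [_root_.zpow_neg] at h1 h2
  have h3 : (ρ' ((A ^ (-k)) *ᵥ x) : ℝ) ≤ M := by
    refine hM _ (hR _ ?_)
    rw [h1, inv_mul_le_iff₀ hdk, ← zpow_add_one₀ hd0.ne']
    exact hk2.le
  rw [h2, inv_mul_le_iff₀ hdk] at h3
  have h4 : M ≤ max M 1 := le_max_left _ _
  have h5 : 0 < max M 1 := by positivity
  nlinarith

/-- Quasi-norms associated with the same dilation are equivalent. -/
theorem quasiNormEquiv (h : IsAssociatedQuasiNorm A ρ) (h' : IsAssociatedQuasiNorm A ρ')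
    (hA : IsExpansive A) : QuasiNormEquiv ρ ρ' := by
  obtain ⟨C, hC, h1⟩ := h.exists_le_mul h' hA
  obtain ⟨D, hD, h2⟩ := h'.exists_le_mul h hA
  refine ⟨max C D, lt_max_of_lt_left hC, fun x => ⟨?_, ?_⟩⟩
  · rw [one_div, inv_mul_le_iff₀ (lt_max_of_lt_left hC)]
    exact (h2 x).trans (mul_le_mul_of_nonneg_right (le_max_right _ _) (ρ' x).2)
  · exact (h1 x).trans (mul_le_mul_of_nonneg_right (le_max_left _ _) (ρ x).2)

end IsAssociatedQuasiNorm

theorem QuasiNormEquiv.symm {ρ ρ' : (Fin n → ℝ) → ℝ≥0} (h : QuasiNormEquiv ρ ρ') :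
    QuasiNormEquiv ρ' ρ := by
  obtain ⟨C, hC, h⟩ := h
  refine ⟨C, hC, fun x => ⟨?_, ?_⟩⟩
  · rw [one_div, inv_mul_le_iff₀ hC]
    exact (h x).2
  · have := (h x).1
    rwa [one_div, inv_mul_le_iff₀ hC] at this

theorem QuasiNormEquiv.trans {ρ ρ' ρ'' : (Fin n → ℝ) → ℝ≥0} (h : QuasiNormEquiv ρ ρ')
    (h' : QuasiNormEquiv ρ' ρ'') : QuasiNormEquiv ρ ρ'' := by
  obtain ⟨C, hC, h⟩ := h
  obtain ⟨D, hD, h'⟩ := h'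
  refine ⟨D * C, by positivity, fun x => ⟨?_, ?_⟩⟩
  · have h1 := (h x).1
    have h2 := (h' x).1
    rw [one_div, inv_mul_le_iff₀ (by positivity)] at h1 h2 ⊢
    nlinarith
  · have h1 := (h x).2
    have h2 := (h' x).2
    nlinarith

end QuasiNorms

/-! ### Gauges of one-parameter groups as quasi-norms, and recovery of the generator. -/

section GroupGauge

open Matrix Filter Topology MeasureTheory
open scoped Matrix.Norms.Operator Nat

variable {n : ℕ}

theorem exp_add_smul_mulVec (P : Matrix (Fin n) (Fin n) ℝ) (s t : ℝ) (x : Fin n → ℝ) :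
    NormedSpace.exp ((s + t) • P) *ᵥ x =
      NormedSpace.exp (s • P) *ᵥ (NormedSpace.exp (t • P) *ᵥ x) := by
  rw [mulVec_mulVec, add_smul,
    Matrix.exp_add_of_commute _ _ (((Commute.refl P).smul_left s).smul_right t)]

theorem continuous_exp_smul (P : Matrix (Fin n) (Fin n) ℝ) :
    Continuous fun s : ℝ => NormedSpace.exp (s • P) :=
  NormedSpace.exp_continuous.comp (continuous_id.smul continuous_const)

theorem exists_norm_exp_neg_smul_le {P : Matrix (Fin n) (Fin n) ℝ}
    (hP : Tendsto (fun s : ℝ => NormedSpace.exp ((-s) • P)) atTop (𝓝 0)) (a : ℝ) :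
    ∃ K : ℝ, 0 < K ∧ ∀ s, a ≤ s → ‖NormedSpace.exp ((-s) • P)‖ ≤ K := by
  have h1 := (tendsto_zero_iff_norm_tendsto_zero.1 hP).eventually_lt_const (u := 1) one_pos
  obtain ⟨T, hT⟩ := eventually_atTop.1 h1
  have hc : Continuous fun s : ℝ => NormedSpace.exp ((-s) • P) :=
    (continuous_exp_smul P).comp continuous_neg
  obtain ⟨C, hC⟩ := (isCompact_Icc (a := a) (b := T)).exists_bound_of_continuousOn hc.continuousOn
  refine ⟨max C 1, by positivity, fun s hs => ?_⟩
  rcases le_total s T with h | h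
  · exact (hC s ⟨hs, h⟩).trans (le_max_left _ _)
  · exact (hT s h).le.trans (le_max_right _ _)

/-- The gauge of `D` with respect to the group `exp (s P)`: the infimum of the `exp s` with
`x ∈ exp (s P) D`. -/
noncomputable def groupGauge (P : Matrix (Fin n) (Fin n) ℝ) (D : Set (Fin n → ℝ))
    (x : Fin n → ℝ) : ℝ≥0 :=
  sInf {t | ∃ s : ℝ, (t : ℝ) = Real.exp s ∧ NormedSpace.exp ((-s) • P) *ᵥ x ∈ D}

/-- Decay of the inverse group, for an open bounded neighbourhood of the origin. -/
structure IsGaugeSet (P : Matrix (Fin n) (Fin n) ℝ) (D : Set (Fin n → ℝ)) : Prop where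
  tendsto : Tendsto (fun s : ℝ => NormedSpace.exp ((-s) • P)) atTop (𝓝 0)
  isOpen : IsOpen D
  zero_mem : 0 ∈ D
  bounded : ∃ R : ℝ, 0 < R ∧ ∀ x ∈ D, ‖x‖ ≤ R

namespace IsGaugeSet

variable {P : Matrix (Fin n) (Fin n) ℝ} {D : Set (Fin n → ℝ)}

theorem exists_mem_of_norm_le (h : IsGaugeSet P D) (R : ℝ) :
    ∃ s : ℝ, ∀ x : Fin n → ℝ, ‖x‖ ≤ R → NormedSpace.exp ((-s) • P) *ᵥ x ∈ D := by
  obtain ⟨r, hr, hball⟩ := Metric.mem_nhds_iff.1 (h.isOpen.mem_nhds h.zero_mem)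
  have h1 : Tendsto (fun s : ℝ => ‖NormedSpace.exp ((-s) • P)‖ * R) atTop (𝓝 0) := by
    simpa using (tendsto_zero_iff_norm_tendsto_zero.1 h.tendsto).mul_const R
  obtain ⟨s, hs⟩ := (h1.eventually_lt_const hr).exists
  refine ⟨s, fun x hx => hball (mem_ball_zero_iff.2 ?_)⟩
  exact ((linfty_opNorm_mulVec _ _).trans (mul_le_mul_of_nonneg_left hx (norm_nonneg _))).trans_lt hs

/-- Strict sublevels avoid any question of whether the infimum is attained; later properties of the
gauge are read off from them. -/
theorem lt_iff (h : IsGaugeSet P D) (x : Fin n → ℝ) (T : ℝ) :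
    (groupGauge P D x : ℝ) < T ↔
      ∃ s : ℝ, Real.exp s < T ∧ NormedSpace.exp ((-s) • P) *ᵥ x ∈ D := by
  rcases lt_or_ge T 0 with hT | hT
  · constructor
    · intro h1
      exact absurd (h1.trans hT) (not_lt.2 (groupGauge P D x).2)
    · rintro ⟨s, hs, -⟩
      exact absurd (hs.trans hT) (not_lt.2 (Real.exp_pos s).le)
  lift T to ℝ≥0 using hT
  rw [NNReal.coe_lt_coe, groupGauge, csInf_lt_iff (OrderBot.bddBelow _)]
  · constructor
    · rintro ⟨t, ⟨s, hts, hs⟩, ht⟩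
      exact ⟨s, hts ▸ NNReal.coe_lt_coe.2 ht, hs⟩
    · rintro ⟨s, hsT, hs⟩
      exact ⟨⟨Real.exp s, (Real.exp_pos s).le⟩, ⟨s, rfl, hs⟩, NNReal.coe_lt_coe.1 hsT⟩
  · obtain ⟨s, hs⟩ := h.exists_mem_of_norm_le ‖x‖
    exact ⟨⟨Real.exp s, (Real.exp_pos s).le⟩, s, rfl, hs x le_rfl⟩

theorem measurable (h : IsGaugeSet P D) : Measurable (groupGauge P D) := by
  refine measurable_of_Iio fun T => IsOpen.measurableSet ?_
  have h1 : groupGauge P D ⁻¹' Set.Iio T = ⋃ s ∈ {s : ℝ | Real.exp s < T},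
      {x | NormedSpace.exp ((-s) • P) *ᵥ x ∈ D} := by
    ext x
    have := h.lt_iff x T
    simpa using this
  rw [h1]
  exact isOpen_biUnion fun s _ => h.isOpen.preimage (continuous_const.matrix_mulVec continuous_id)

theorem groupGauge_exp_smul_mulVec (h : IsGaugeSet P D) (u : ℝ) (x : Fin n → ℝ) :
    (groupGauge P D (NormedSpace.exp (u • P) *ᵥ x) : ℝ) = Real.exp u * groupGauge P D x := by
  refine eq_of_forall_gt_iff fun T => ?_
  rw [h.lt_iff, ← lt_div_iff₀' (Real.exp_pos u), h.lt_iff]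
  constructor
  · rintro ⟨s, hs, hD⟩
    refine ⟨s - u, ?_, ?_⟩
    · rw [Real.exp_sub]
      exact div_lt_div_of_pos_right hs (Real.exp_pos u)
    · rwa [neg_sub, sub_eq_neg_add, exp_add_smul_mulVec]
  · rintro ⟨s, hs, hD⟩
    refine ⟨s + u, ?_, ?_⟩
    · rw [Real.exp_add]
      exact (lt_div_iff₀ (Real.exp_pos u)).1 hs
    · rwa [← exp_add_smul_mulVec, neg_add, neg_add_cancel_right]

theorem groupGauge_eq_zero_iff (h : IsGaugeSet P D) (x : Fin n → ℝ) :
    groupGauge P D x = 0 ↔ x = 0 := by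
  constructor
  · intro h0
    by_contra hx
    obtain ⟨R, hR, hDR⟩ := h.bounded
    have h1 : Tendsto (fun s : ℝ => ‖NormedSpace.exp ((-s) • P)‖ * R) atTop (𝓝 0) := by
      simpa using (tendsto_zero_iff_norm_tendsto_zero.1 h.tendsto).mul_const R
    obtain ⟨s₀, hs₀⟩ := eventually_atTop.1 (h1.eventually_lt_const (norm_pos_iff.2 hx))
    have h2 : (groupGauge P D x : ℝ) < Real.exp (-s₀) := by
      rw [h0]
      exact Real.exp_pos _
    obtain ⟨s, hs, hD⟩ := (h.lt_iff _ _).1 h2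
    have h3 := hs₀ (-s) (by linarith [Real.exp_lt_exp.1 hs])
    have h4 : x = NormedSpace.exp ((- -s) • P) *ᵥ (NormedSpace.exp ((-s) • P) *ᵥ x) := by
      rw [← exp_add_smul_mulVec]
      simp
    have h5 : ‖x‖ ≤ ‖NormedSpace.exp ((- -s) • P)‖ * R := by
      conv_lhs => rw [h4]
      exact (linfty_opNorm_mulVec _ _).trans (mul_le_mul_of_nonneg_left (hDR _ hD) (norm_nonneg _))
    linarith
  · rintro rfl
    have h1 : (groupGauge P D 0 : ℝ) ≤ 0 := by
      refine le_of_forall_gt fun T hT => (h.lt_iff _ _).2 ⟨Real.log (T / 2), ?_, ?_⟩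
      · rw [Real.exp_log (by positivity)]
        linarith
      · rw [mulVec_zero]
        exact h.zero_mem
    exact_mod_cast le_antisymm h1 (groupGauge P D 0).2

/-- Pulled back by the larger of their two scales, x and y both have norm at most KR; a further
fixed time s₀ brings the sum into D, whence the constant exp s₀. -/
theorem quasi_triangle (h : IsGaugeSet P D) :
    ∃ c : ℝ, ∀ x y, (groupGauge P D (x + y) : ℝ) ≤ c * (groupGauge P D x + groupGauge P D y) := by
  obtain ⟨R, hR, hDR⟩ := h.bounded
  obtain ⟨K, hK, hKb⟩ := exists_norm_exp_neg_smul_le h.tendsto 0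
  obtain ⟨s₀, hs₀⟩ := h.exists_mem_of_norm_le (K * R + K * R)
  refine ⟨Real.exp s₀, fun x y => ?_⟩
  refine le_of_forall_gt fun T hT => ?_
  have hE := Real.exp_pos s₀
  obtain ⟨ε, hε, hεT⟩ : ∃ ε > 0, Real.exp s₀ * ((groupGauge P D x + ε) + (groupGauge P D y + ε))
      < T := by
    refine ⟨(T - Real.exp s₀ * (groupGauge P D x + groupGauge P D y)) / (4 * Real.exp s₀),
      div_pos (by linarith) (by positivity), ?_⟩
    have : Real.exp s₀ * ((T - Real.exp s₀ * (groupGauge P D x + groupGauge P D y)) /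
      (4 * Real.exp s₀)) = (T - Real.exp s₀ * (groupGauge P D x + groupGauge P D y)) / 4 := by
      field_simp
    linarith
  obtain ⟨s, hs, hxs⟩ := (h.lt_iff x _).1 (lt_add_of_pos_right (groupGauge P D x : ℝ) hε)
  obtain ⟨t, ht, hyt⟩ := (h.lt_iff y _).1 (lt_add_of_pos_right (groupGauge P D y : ℝ) hε)
  have key : ∀ (z : Fin n → ℝ) (r : ℝ), r ≤ max s t → NormedSpace.exp ((-r) • P) *ᵥ z ∈ D →
      ‖NormedSpace.exp ((-(max s t)) • P) *ᵥ z‖ ≤ K * R := by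
    intro z r hr hz
    have h1 : -(max s t) = -(max s t - r) + -r := by ring
    rw [h1, exp_add_smul_mulVec]
    exact (linfty_opNorm_mulVec _ _).trans
      (mul_le_mul (hKb _ (by linarith)) (hDR _ hz) (norm_nonneg _) hK.le)
  refine (h.lt_iff _ _).2 ⟨s₀ + max s t, lt_of_le_of_lt ?_ hεT, ?_⟩
  · rw [Real.exp_add]
    refine mul_le_mul_of_nonneg_left ?_ hE.le
    have h1 := Real.exp_pos s
    have h2 := Real.exp_pos t
    rcases max_choice s t with h3 | h3 <;> rw [h3] <;> linarith
  · rw [neg_add, exp_add_smul_mulVec]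
    refine hs₀ _ ?_
    rw [mulVec_add]
    exact (norm_add_le _ _).trans
      (add_le_add (key x s (le_max_left _ _) hxs) (key y t (le_max_right _ _) hyt))

theorem isAssociatedQuasiNorm (h : IsGaugeSet P D) {A : Matrix (Fin n) (Fin n) ℝ}
    (hA : ∀ x, (groupGauge P D (A *ᵥ x) : ℝ) = |A.det| * groupGauge P D x) :
    IsAssociatedQuasiNorm A (groupGauge P D) where
  measurable := h.measurable.nullMeasurable
  eq_zero_iff := h.groupGauge_eq_zero_iff
  homogeneous := hA
  quasi_triangle := h.quasi_triangle

theorem isAssociatedQuasiNorm_continuousGroup (h : IsGaugeSet P D) (hP : P.trace = 1) {t : ℝ}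
    (ht : 1 < t) : IsAssociatedQuasiNorm (continuousGroup P t) (groupGauge P D) := by
  have ht0 : 0 < t := by linarith
  refine h.isAssociatedQuasiNorm fun x => ?_
  rw [continuousGroup, h.groupGauge_exp_smul_mulVec, det_exp_smul, hP, mul_one, Real.exp_log ht0,
    abs_of_pos ht0]

end IsGaugeSet

theorem isGaugeSet_ball {P : Matrix (Fin n) (Fin n) ℝ}
    (hP : ∀ z : ℂ, IsComplexEigenvalue P z → z.im = 0 ∧ 0 < z.re) :
    IsGaugeSet P (Metric.ball 0 1) where
  tendsto := tendsto_exp_neg_smul_zero P fun z hz => (hP z hz).2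
  isOpen := Metric.isOpen_ball
  zero_mem := by simp
  bounded := ⟨1, one_pos, fun _ hx => (mem_ball_zero_iff.1 hx).le⟩

/-- exp(sQ) carries the unit ball into {gauge of Q < exp s}, hence into {gauge of P < C exp s};
exp(-sP) brings this back to a bounded set, uniformly in s. -/
theorem eq_of_quasiNormEquiv_groupGauge {P Q : Matrix (Fin n) (Fin n) ℝ}
    (hP : ∀ z : ℂ, IsComplexEigenvalue P z → z.im = 0 ∧ 0 < z.re)
    (hQ : ∀ z : ℂ, IsComplexEigenvalue Q z → z.im = 0 ∧ 0 < z.re)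
    (h : QuasiNormEquiv (groupGauge P (Metric.ball 0 1)) (groupGauge Q (Metric.ball 0 1))) :
    P = Q := by
  have gP := isGaugeSet_ball hP
  have gQ := isGaugeSet_ball hQ
  obtain ⟨C, hC, hCb⟩ := h.symm
  -- The comparison constant shifts time by log C, so the residual time s - r is only known to
  -- exceed -log C.
  obtain ⟨K, hK, hKb⟩ := exists_norm_exp_neg_smul_le gP.tendsto (-Real.log C)
  have hbound : ∀ (s : ℝ) (x : Fin n → ℝ), ‖x‖ < 1 →
      ‖(NormedSpace.exp ((-s) • P) * NormedSpace.exp (s • Q)) *ᵥ x‖ ≤ K := by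
    intro s x hx
    set y := NormedSpace.exp (s • Q) *ᵥ x with hy
    have h1 : (groupGauge Q (Metric.ball 0 1) x : ℝ) < 1 := by
      obtain ⟨δ, hδ, hδx⟩ : ∃ δ : ℝ, 0 < δ ∧
          NormedSpace.exp ((- -δ) • Q) *ᵥ x ∈ Metric.ball (0 : Fin n → ℝ) 1 := by
        have hc : Continuous fun δ : ℝ => NormedSpace.exp ((- -δ) • Q) *ᵥ x :=
          ((continuous_exp_smul Q).comp (continuous_neg.comp continuous_neg)).matrix_mulVec
            continuous_const
        have h2 : ∀ᶠ δ in 𝓝 (0 : ℝ),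
            NormedSpace.exp ((- -δ) • Q) *ᵥ x ∈ Metric.ball (0 : Fin n → ℝ) 1 :=
          hc.continuousAt.eventually_mem (Metric.isOpen_ball.mem_nhds (by simpa using hx))
        obtain ⟨δ, h3, h4⟩ := ((h2.filter_mono nhdsWithin_le_nhds).and
          (self_mem_nhdsWithin (s := Set.Ioi (0 : ℝ)))).exists
        exact ⟨δ, h4, h3⟩
      exact (gQ.lt_iff _ _).2 ⟨-δ, by simpa using hδ, hδx⟩
    have h2 : (groupGauge Q (Metric.ball 0 1) y : ℝ) < Real.exp s := by
      rw [hy, gQ.groupGauge_exp_smul_mulVec]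
      nlinarith [Real.exp_pos s]
    have h3 : (groupGauge P (Metric.ball 0 1) y : ℝ) < Real.exp (s + Real.log C) := by
      rw [Real.exp_add, Real.exp_log hC, mul_comm]
      exact ((hCb y).2).trans_lt (mul_lt_mul_of_pos_left h2 hC)
    obtain ⟨r, hr, hyr⟩ := (gP.lt_iff _ _).1 h3
    have hr' := Real.exp_lt_exp.1 hr
    rw [← mulVec_mulVec, ← hy, show -s = -(s - r) + -r by ring, exp_add_smul_mulVec]
    refine (linfty_opNorm_mulVec _ _).trans ?_
    have h4 := hKb (s - r) (by linarith)
    have h5 := (mem_ball_zero_iff.1 hyr).le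
    nlinarith [norm_nonneg (NormedSpace.exp ((-(s - r)) • P))]
  refine eq_of_exp_mul_exp_bounded P Q (fun z hz => (hP z hz).1) (fun z hz => (hQ z hz).1)
    (∑ _j : Fin n, 2 * K) fun s => ?_
  refine (linfty_opNorm_le_sum_col _).trans (Finset.sum_le_sum fun j _ => ?_)
  have hsingle : (Pi.single j 1 : Fin n → ℂ) = fun i => ((Pi.single j 1 : Fin n → ℝ) i : ℂ) := by
    ext i
    by_cases hij : i = j
    · subst hij; simp
    · simp [hij]
  rw [hsingle, complexify_mulVec]
  -- Basis vectors are halved to enter the open unit ball, whence 2K.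
  have h1 := hbound s ((1 / 2 : ℝ) • Pi.single j 1) (by
    rw [norm_smul]
    have : ‖(Pi.single j 1 : Fin n → ℝ)‖ ≤ 1 := by simp [Pi.norm_single]
    norm_num
    linarith)
  rw [mulVec_smul, norm_smul] at h1
  refine (pi_norm_le_iff_of_nonneg (by positivity)).2 fun i => ?_
  rw [Complex.norm_real]
  refine (norm_le_pi_norm _ i).trans ?_
  norm_num at h1 ⊢
  linarith

end GroupGauge

/-! ### Existence and uniqueness of the generator. -/

section Generators

open Matrix Filter Topology MeasureTheory
open scoped Matrix.Norms.Operator Nat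

variable {n : ℕ}

theorem isAnisotropicDilation_of_tendsto {B : Matrix (Fin n) (Fin n) ℝ} (hB : IsUnit B.det)
    (h : Tendsto (fun k : ℕ => B⁻¹ ^ k) atTop (𝓝 0)) : IsAnisotropicDilation B := by
  intro z hz
  obtain ⟨v, hv, hBv⟩ := (hasEigenvalue_toLin'_iff _ _).1 hz
  have hz0 : z ≠ 0 := by
    rintro rfl
    apply hv
    have := congrArg (fun w => complexify B⁻¹ *ᵥ w) hBv
    rw [mulVec_mulVec] at this
    change (complexify B⁻¹ * complexify B) *ᵥ v = _ at this
    rwa [← map_mul, Matrix.nonsing_inv_mul _ hB, map_one, one_mulVec, zero_smul,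
      mulVec_zero] at this
  have hv' : 0 < ‖v‖ := norm_pos_iff.2 hv
  have hz' : 0 < ‖z‖ := norm_pos_iff.2 hz0
  by_contra! hle
  obtain ⟨k, hk⟩ := ((tendsto_zero_iff_norm_tendsto_zero.1 h).eventually_lt_const
    (u := 1) one_pos).exists
  have h1 := complexify_zpow_mulVec B hB hz0 hBv (-k)
  rw [Matrix.zpow_neg_natCast, ← Matrix.inv_pow', _root_.zpow_neg, zpow_natCast] at h1
  have h2 := linfty_opNorm_mulVec (complexify (B⁻¹ ^ k)) v
  rw [h1, norm_complexify, norm_smul, norm_inv, norm_pow] at h2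
  have h3 := le_of_mul_le_mul_right h2 hv'
  have h4 : 1 ≤ (‖z‖ ^ k)⁻¹ := (one_le_inv₀ (by positivity)).2 (pow_le_one₀ hz'.le hle)
  linarith

theorem isAnisotropicDilation_continuousGroup {P : Matrix (Fin n) (Fin n) ℝ}
    (hP : Tendsto (fun s : ℝ => NormedSpace.exp ((-s) • P)) atTop (𝓝 0)) {t : ℝ} (ht : 1 < t) :
    IsAnisotropicDilation (continuousGroup P t) := by
  refine isAnisotropicDilation_of_tendsto
    ((Matrix.isUnit_iff_isUnit_det _).1 (Matrix.isUnit_exp _)) ?_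
  have h1 : (fun k : ℕ => (continuousGroup P t)⁻¹ ^ k) =
      fun k : ℕ => NormedSpace.exp ((-((k : ℝ) * Real.log t)) • P) := by
    funext k
    rw [continuousGroup, ← Matrix.exp_neg, ← Matrix.exp_nsmul, ← Nat.cast_smul_eq_nsmul ℝ,
      smul_neg, smul_smul, neg_smul]
  rw [h1]
  exact hP.comp (tendsto_natCast_atTop_atTop.atTop_mul_const (Real.log_pos ht))

/-- This puts a quasi-norm in a normal form depending only on `P`; one value t = 2 is enough. -/
theorem IsAssociatedGenerator.quasiNormEquiv [NeZero n] {A P : Matrix (Fin n) (Fin n) ℝ}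
    (h : IsAssociatedGenerator A P) {ρ : (Fin n → ℝ) → ℝ≥0} (hρ : IsAssociatedQuasiNorm A ρ) :
    QuasiNormEquiv ρ (groupGauge P (Metric.ball 0 1)) := by
  obtain ⟨hA, hB, ρ₁, ρ₂, hρ₁, hρ₂, he⟩ := h.equiv 2 one_lt_two
  have hg := (isGaugeSet_ball h.eigenvalue_pos).isAssociatedQuasiNorm_continuousGroup
    h.trace_eq_one one_lt_two
  exact ((hρ.quasiNormEquiv hρ₁ hA.isExpansive).trans he).trans
    (hρ₂.quasiNormEquiv hg hB.isExpansive)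

theorem IsAssociatedGenerator.unique [NeZero n] {A P Q : Matrix (Fin n) (Fin n) ℝ}
    (hP : IsAssociatedGenerator A P) (hQ : IsAssociatedGenerator A Q) : P = Q := by
  obtain ⟨-, -, ρ, -, hρ, -⟩ := hP.equiv 2 one_lt_two
  exact eq_of_quasiNormEquiv_groupGauge hP.eigenvalue_pos hQ.eigenvalue_pos
    ((hP.quasiNormEquiv hρ).symm.trans (hQ.quasiNormEquiv hρ))

theorem IsAnisotropicDilation.exists_isAssociatedGenerator [NeZero n]
    {A : Matrix (Fin n) (Fin n) ℝ} (hA : IsAnisotropicDilation A) :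
    ∃ P, IsAssociatedGenerator A P := by
  obtain ⟨L, U, hLU, hA', hU, ⟨C, hC⟩, hL⟩ := exists_exp_mul_zpow_bounded A hA
  have hdet : |A.det| = Real.exp L.trace := by
    have := det_exp_smul L 1
    rw [one_smul, one_mul] at this
    rw [hA', det_mul, abs_mul, abs_det_eq_one_of_zpow_bounded U hU C hC, mul_one, this,
      abs_of_pos (Real.exp_pos _)]
  have hτ : 0 < L.trace := by
    have := hA.isExpansive.one_lt_det
    rwa [hdet, Real.one_lt_exp_iff] at this
  set P := L.trace⁻¹ • L with hPdef
  have hLP : L = L.trace • P := by rw [hPdef, smul_smul, mul_inv_cancel₀ hτ.ne', one_smul]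
  have hPev : ∀ z : ℂ, IsComplexEigenvalue P z → z.im = 0 ∧ 0 < z.re := by
    intro z hz
    obtain ⟨v, hv, hPv⟩ := (hasEigenvalue_toLin'_iff _ _).1 hz
    have h1 := hL (L.trace * z) ((hasEigenvalue_toLin'_iff _ _).2 ⟨v, hv, by
      conv_lhs => rw [hLP]
      rw [complexify_smul, smul_mulVec]
      change _ • (P.map (algebraMap ℝ ℂ) *ᵥ v) = _
      rw [hPv, smul_smul]⟩)
    rw [Complex.im_ofReal_mul, Complex.re_ofReal_mul] at h1
    exact ⟨(mul_eq_zero.1 h1.1).resolve_left hτ.ne', pos_of_mul_pos_right h1.2 hτ.le⟩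
  have hPtr : P.trace = 1 := by
    rw [hPdef, trace_smul, smul_eq_mul, inv_mul_cancel₀ hτ.ne']
  have hdecay := tendsto_exp_neg_smul_zero P fun z hz => (hPev z hz).2
  -- The union of all U-translates of the unit ball: invariant under U, and bounded because the
  -- powers of U are.
  let D : Set (Fin n → ℝ) := {x | ∃ k : ℤ, ‖(U ^ k) *ᵥ x‖ < 1}
  have hD : IsGaugeSet P D := by
    refine ⟨hdecay, ?_, ⟨0, by simp⟩, max C 1, by positivity, ?_⟩
    · rw [show D = ⋃ k : ℤ, {x | ‖(U ^ k) *ᵥ x‖ < 1} by ext x; simp [D]]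
      exact isOpen_iUnion fun k => isOpen_lt
        (continuous_const.matrix_mulVec continuous_id).norm continuous_const
    · rintro x ⟨k, hk⟩
      have h1 : x = (U ^ (-k)) *ᵥ ((U ^ k) *ᵥ x) := by
        rw [mulVec_mulVec, Matrix.zpow_neg_mul_zpow_self k hU, one_mulVec]
      rw [h1]
      refine (linfty_opNorm_mulVec _ _).trans ?_
      have h2 := hC (-k)
      have h3 := le_max_left C 1
      nlinarith [norm_nonneg (U ^ (-k)), norm_nonneg ((U ^ k) *ᵥ x)]
  have hUD : ∀ x, U *ᵥ x ∈ D ↔ x ∈ D := by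
    intro x
    constructor
    · rintro ⟨k, hk⟩
      exact ⟨k + 1, by rwa [Matrix.zpow_add_one hU, ← mulVec_mulVec]⟩
    · rintro ⟨k, hk⟩
      exact ⟨k - 1, by rwa [mulVec_mulVec, ← Matrix.zpow_add_one hU, sub_add_cancel]⟩
  have hUP : Commute P U := hLU.smul_left _
  have hUg : ∀ x, groupGauge P D (U *ᵥ x) = groupGauge P D x := by
    intro x
    have h1 : ∀ s : ℝ, NormedSpace.exp ((-s) • P) *ᵥ (U *ᵥ x) ∈ D ↔
        NormedSpace.exp ((-s) • P) *ᵥ x ∈ D := by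
      intro s
      rw [← hUD (NormedSpace.exp ((-s) • P) *ᵥ x), mulVec_mulVec, mulVec_mulVec,
        ((hUP.smul_left (-s)).exp_left).eq]
    simp only [groupGauge, h1]
  have hρA : IsAssociatedQuasiNorm A (groupGauge P D) := by
    refine hD.isAssociatedQuasiNorm fun x => ?_
    have h1 : A *ᵥ x = NormedSpace.exp (L.trace • P) *ᵥ (U *ᵥ x) := by
      rw [← hLP, mulVec_mulVec, ← hA']
    rw [h1, hD.groupGauge_exp_smul_mulVec, hUg, hdet]
  refine ⟨P, hPev, hPtr, fun t ht => ⟨hA, isAnisotropicDilation_continuousGroup hdecay ht,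
    groupGauge P D, groupGauge P D, hρA, hD.isAssociatedQuasiNorm_continuousGroup hPtr ht,
    1, one_pos, fun x => by simp⟩⟩

end Generators

theorem corollary3p2 (n : ℕ) (hn : 0 < n) :
    (∀ A : Matrix (Fin n) (Fin n) ℝ, IsAnisotropicDilation A →
      ∃! P : Matrix (Fin n) (Fin n) ℝ, IsAssociatedGenerator A P) ∧
    (∀ A₁ A₂ : Matrix (Fin n) (Fin n) ℝ,
      IsAnisotropicDilation A₁ → IsAnisotropicDilation A₂ →
      ∀ ρ₁ ρ₂ : (Fin n → ℝ) → ℝ≥0,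
      IsAssociatedQuasiNorm A₁ ρ₁ → IsAssociatedQuasiNorm A₂ ρ₂ →
      ∀ P₁ P₂ : Matrix (Fin n) (Fin n) ℝ,
      IsAssociatedGenerator A₁ P₁ → IsAssociatedGenerator A₂ P₂ →
      (QuasiNormEquiv ρ₁ ρ₂ ↔ P₁ = P₂)) := by
  have : NeZero n := ⟨hn.ne'⟩
  refine ⟨fun A hA => ?_, fun A₁ A₂ _ _ ρ₁ ρ₂ hρ₁ hρ₂ P₁ P₂ hP₁ hP₂ => ⟨fun h => ?_, ?_⟩⟩
  · obtain ⟨P, hP⟩ := hA.exists_isAssociatedGenerator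
    exact ⟨P, hP, fun Q hQ => hQ.unique hP⟩
  · exact eq_of_quasiNormEquiv_groupGauge hP₁.eigenvalue_pos hP₂.eigenvalue_pos
      (((hP₁.quasiNormEquiv hρ₁).symm.trans h).trans (hP₂.quasiNormEquiv hρ₂))
  · rintro rfl
    exact (hP₁.quasiNormEquiv hρ₁).trans (hP₂.quasiNormEquiv hρ₂).symm
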